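/- **Spaces of diagrams.** Let $F$ be a functor from free abelian groups of finite rank (with linear isomorphisms) to $\mathbb{Q}$-vector spaces. $\mathcal{D}(F)$ is the quotient of $\bigoplus_\Gamma F(H^1(\Gamma,\mathbb{Z}))$, where $\Gamma$ runs over finite trivalent graphs with a cyclic orientation at each vertex (circle components are allowed), by the following relations: isomorphic decorated graphs are identified; reversing the orientation at one vertex changes the sign; and $x_I=x_H-x_X$ for the three resolutions of a four-valent vertex. Put $\mathcal{B}=\mathcal{D}(H\mapsto\mathbb{Q}[[H]])$ (completed uni-trivalent diagrams: a leg attached to an oriented edge stands for the cohomology class of this edge) and $\mathcal{B}_s=\mathcal{D}\bigl(H\mapsto (H\setminus\{0\})^{-1}\mathbb{Q}[[H]]\bigr)$. Localization induces a map $\mathcal{B}\to\mathcal{B}_s$. **Substitution.** Let $X$ be a finite connected unoriented graph (a gluing graph; loops and multiple edges are allowed) with vertices $x_1,\dots,x_N$ of valencies $k_1,\dots,k_N$, and attach to each $x_i$ a power series $f_i\in\mathbb{Q}[[x]]$. The monomial $x^n$ stands for the wheel with $n$ legs, i.e. a circle with $n$ outward legs. The substitution $s(X)\in\mathcal{B}$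 is the sum over all ways of gluing, for every $i$, the $k_i$ edge-ends at $x_i$ to distinct legs of wheels generated by $f_i$. For every choice $\sigma$ of a cyclic ordering of the edge-ends at each vertex, let $\Gamma_\sigma$ be the trivalent graph obtained from $X$ by gluing at each vertex the incoming edges to a circle in the order prescribed by $\sigma$. **Proposition.** The image of $s(X)$ in $\mathcal{B}_s$ is a finite $\mathbb{Q}$-linear combination of diagrams $\Gamma=\Gamma_\sigma$ decorated by expressions $$\prod_{i=1}^{N}\frac{f_i^{(k_i-p_i)}(y_i)}{D_i},$$ where the $y_i\in H^1(\Gamma,\mathbb{Z})$ are nonzero, $p_i$ is an integer with $0\le p_i\le k_i-1$ (and $p_i=0$ if $k_i=0$), and $D_i$ is a product of $p_i$ nonzero elements of $H^1(\Gamma,\mathbb{Z})$. Moreover $\sum_i p_i>0$ in every term, unless $X$ is a tree. The coefficients, orderings, $y_i$, $p_i$ and $D_i$ can be chosen depending on $X$ only, the same for all series $f_1,\dots,f_N$. The same holds, for another finite family of coefficients, orderings, $y_i$, $p_i$ and $D_i$ with the same properties, with the factors $f_i^{(k_i-p_i)}(y_i)/D_i$ replaced, at every vertex with $k_i\ge1$,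 by $$y_i^{p_i}\left(\frac{f_i'(y_i)}{y_i^{p_i}}\right)^{(k_i-p_i-1)}\Big/D_i ,$$ the derivative being that of the Laurent series $f_i'(x)/x^{p_i}$ evaluated at $x=y_i$ (if $k_i=0$ the factor is still $f_i(y_i)$). -/

import Mathlib

noncomputable section

namespace GluingDiagrams

open CategoryTheory
open scoped Classical

/-! ### Lattices and modules over the category of lattices -/

/-- A free abelian group of finite rank. -/
structure Lattice where
  carrier : Type
  [addCommGroup : AddCommGroup carrier]
  [free : Module.Free ℤ carrier]
  [finite : Module.Finite ℤ carrier]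

attribute [instance] Lattice.addCommGroup Lattice.free Lattice.finite

/-- The category of free abelian groups of finite rank and linear isomorphisms. -/
instance : Category Lattice where
  Hom A B := A.carrier ≃ₗ[ℤ] B.carrier
  id A := LinearEquiv.refl ℤ A.carrier
  comp f g := f.trans g

/-- Functors from lattices (with isomorphisms) to rational vector spaces. -/
abbrev CModule := Lattice ⥤ ModuleCat.{0} ℚ

section PowerSeriesRing

variable (H K L : Type) [AddCommGroup H] [Module.Free ℤ H] [Module.Finite ℤ H]
  [AddCommGroup K] [Module.Free ℤ K] [Module.Finite ℤ K]
  [AddCommGroup L] [Module.Free ℤ L] [Module.Finite ℤ L]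

/-- `ℚ[[H]] = ∏ₙ Sⁿ(H ⊗ ℚ)`, written as the ring of formal power series in a basis of `H`. -/
abbrev PSRing : Type := MvPowerSeries (Module.Free.ChooseBasisIndex ℤ H) ℚ

variable {H K L}

/-- The element `h` of `H`, seen in degree one of `ℚ[[H]]`. -/
def lin (h : H) : PSRing H :=
  ∑ i, ((Module.Free.chooseBasis ℤ H).repr h i) • (MvPowerSeries.X i : PSRing H)

theorem lin_add (h h' : H) : lin (h + h') = lin h + lin h' := by
  simp [lin, add_smul, Finset.sum_add_distrib]

theorem lin_zsmul (n : ℤ) (h : H) : lin (n • h) = n • lin h := by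
  simp [lin, mul_smul, Finset.smul_sum]

theorem lin_sum {ι : Type} (s : Finset ι) (g : ι → H) :
    lin (∑ i ∈ s, g i) = ∑ i ∈ s, lin (g i) := by
  induction s using Finset.induction_on with
  | empty => simp [lin]
  | insert a s ha ih => rw [Finset.sum_insert ha, Finset.sum_insert ha, lin_add, ih]

theorem lin_basis (i : Module.Free.ChooseBasisIndex ℤ H) :
    lin (Module.Free.chooseBasis ℤ H i) = MvPowerSeries.X i := by
  simp [lin, Finsupp.single_apply, ite_smul]

theorem constantCoeff_lin (h : H) : MvPowerSeries.constantCoeff (lin h) = 0 := by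
  simp [lin]

theorem hasSubst_lin {ι : Type} [Finite ι] (x : ι → H) :
    MvPowerSeries.HasSubst (fun i => lin (x i)) :=
  MvPowerSeries.hasSubst_of_constantCoeff_zero fun i => constantCoeff_lin (x i)

/-- The substitution of classes of `H` for the variables of a power series. -/
def evalSeries {ι : Type} [Finite ι] (x : ι → H) : MvPowerSeries ι ℚ →ₐ[ℚ] PSRing H :=
  MvPowerSeries.substAlgHom (hasSubst_lin x)

/-- The map `ℚ[[H]] → ℚ[[K]]` induced by an isomorphism `H ≃ K`. -/
def psMap (e : H ≃ₗ[ℤ] K) : PSRing H →ₐ[ℚ] PSRing K :=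
  evalSeries fun i => e (Module.Free.chooseBasis ℤ H i)

theorem psMap_X (e : H ≃ₗ[ℤ] K) (i : Module.Free.ChooseBasisIndex ℤ H) :
    psMap e (MvPowerSeries.X i) = lin (e (Module.Free.chooseBasis ℤ H i)) := by
  rw [psMap, evalSeries, MvPowerSeries.substAlgHom_X]

theorem psMap_lin (e : H ≃ₗ[ℤ] K) (h : H) : psMap e (lin h) = lin (e h) := by
  conv_rhs => rw [← (Module.Free.chooseBasis ℤ H).sum_repr h]
  rw [map_sum, lin_sum, lin, map_sum]
  refine Finset.sum_congr rfl fun i _ => ?_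
  rw [map_zsmul, map_zsmul, psMap_X, lin_zsmul]

theorem psMap_refl (f : PSRing H) : psMap (LinearEquiv.refl ℤ H) f = f := by
  simp only [psMap, evalSeries, LinearEquiv.refl_apply, lin_basis,
    MvPowerSeries.substAlgHom_apply, MvPowerSeries.subst_self, id]

theorem psMap_trans (e : H ≃ₗ[ℤ] K) (e' : K ≃ₗ[ℤ] L) (f : PSRing H) :
    psMap (e.trans e') f = psMap e' (psMap e f) := by
  have h := MvPowerSeries.subst_comp_subst_apply (R := ℚ)
    (hasSubst_lin fun i => e (Module.Free.chooseBasis ℤ H i))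
    (hasSubst_lin fun i => e' (Module.Free.chooseBasis ℤ K i)) f
  simp only [psMap, evalSeries, MvPowerSeries.substAlgHom_apply]
  rw [h]
  congr 1
  funext i
  have := psMap_lin e' (e (Module.Free.chooseBasis ℤ H i))
  simp only [psMap, evalSeries, MvPowerSeries.substAlgHom_apply] at this
  rw [this]
  rfl

variable (H) in
/-- The multiplicative set generated by `H \ {0}`. -/
def linMonoid : Submonoid (PSRing H) := Submonoid.closure {x | ∃ h : H, h ≠ 0 ∧ x = lin h}

variable (H) in
/-- `(H \ {0})⁻¹ ℚ[[H]]`. -/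
abbrev LocRing : Type := Localization (linMonoid H)

theorem linMonoid_le_comap (e : H ≃ₗ[ℤ] K) :
    linMonoid H ≤ (linMonoid K).comap (psMap e : PSRing H →+* PSRing K) := by
  rw [linMonoid, Submonoid.closure_le]
  rintro _ ⟨h, hh, rfl⟩
  refine Submonoid.subset_closure ⟨e h, by simpa using hh, ?_⟩
  exact psMap_lin e h

/-- The map `(H \ {0})⁻¹ ℚ[[H]] → (K \ {0})⁻¹ ℚ[[K]]` induced by an isomorphism `H ≃ K`. -/
def locMap (e : H ≃ₗ[ℤ] K) : LocRing H →ₐ[ℚ] LocRing K :=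
  (IsLocalization.map (LocRing K) (psMap e : PSRing H →+* PSRing K)
    (linMonoid_le_comap e) : LocRing H →+* LocRing K).toRatAlgHom

theorem locMap_algebraMap (e : H ≃ₗ[ℤ] K) (f : PSRing H) :
    locMap e (algebraMap (PSRing H) (LocRing H) f) =
      algebraMap (PSRing K) (LocRing K) (psMap e f) :=
  IsLocalization.map_eq (linMonoid_le_comap e) f

theorem locMap_refl (f : LocRing H) : locMap (LinearEquiv.refl ℤ H) f = f := by
  have : (locMap (LinearEquiv.refl ℤ H) : LocRing H →+* LocRing H) = RingHom.id _ := by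
    refine IsLocalization.ringHom_ext (linMonoid H) (RingHom.ext fun x => ?_)
    simpa [psMap_refl] using locMap_algebraMap (LinearEquiv.refl ℤ H) x
  exact RingHom.congr_fun this f

theorem locMap_trans (e : H ≃ₗ[ℤ] K) (e' : K ≃ₗ[ℤ] L) (f : LocRing H) :
    locMap (e.trans e') f = locMap e' (locMap e f) := by
  have : (locMap (e.trans e') : LocRing H →+* LocRing L) =
      (locMap e' : LocRing K →+* LocRing L).comp (locMap e : LocRing H →+* LocRing K) := by
    refine IsLocalization.ringHom_ext (linMonoid H) (RingHom.ext fun x => ?_)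
    have h1 := locMap_algebraMap (e.trans e') x
    have h2 := locMap_algebraMap e x
    have h3 := locMap_algebraMap e' (psMap e x)
    simp only [RingHom.comp_apply, RingHom.coe_coe]
    rw [h1, h2, h3, psMap_trans]
  exact RingHom.congr_fun this f

end PowerSeriesRing

/-- The functor `H ↦ ℚ[[H]]`. -/
def psFunctor : CModule where
  obj H := ModuleCat.of ℚ (PSRing H.carrier)
  map e := ModuleCat.ofHom (psMap e).toLinearMap
  map_id H := by
    refine ModuleCat.hom_ext (LinearMap.ext fun f => ?_)
    exact psMap_refl f
  map_comp e e' := by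
    refine ModuleCat.hom_ext (LinearMap.ext fun f => ?_)
    exact psMap_trans e e' f

/-- The functor `H ↦ (H \ {0})⁻¹ ℚ[[H]]`. -/
def locFunctor : CModule where
  obj H := ModuleCat.of ℚ (LocRing H.carrier)
  map e := ModuleCat.ofHom (locMap e).toLinearMap
  map_id H := by
    refine ModuleCat.hom_ext (LinearMap.ext fun f => ?_)
    exact locMap_refl f
  map_comp e e' := by
    refine ModuleCat.hom_ext (LinearMap.ext fun f => ?_)
    exact locMap_trans e e' f

/-- The localization `ℚ[[H]] → (H \ {0})⁻¹ ℚ[[H]]`. -/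
def locTrans : psFunctor ⟶ locFunctor where
  app H := ModuleCat.ofHom (Algebra.linearMap (PSRing H.carrier) (LocRing H.carrier) |>.restrictScalars ℚ)
  naturality H K e := by
    refine ModuleCat.hom_ext (LinearMap.ext fun f => ?_)
    exact (locMap_algebraMap e f).symm

/-! ### Trivalent graphs and diagrams decorated by a functor -/

/-- A trivalent graph with local orientations, some of whose components may be circles.
`D` is the set of oriented edges and `inv` reverses an edge. A vertex is a three-element orbit
`{d, rot d, rot (rot d)}`, consisting of the edges that leave it, in their cyclic order.
The two orientations of a circle component are fixed by `rot`. -/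
structure TriGraph (D : Type) where
  inv : D → D
  rot : D → D
  inv_inv : ∀ d, inv (inv d) = d
  inv_ne : ∀ d, inv d ≠ d
  rot_rot_rot : ∀ d, rot (rot (rot d)) = d
  rot_inv : ∀ d, rot d = d → rot (inv d) = inv d

namespace TriGraph

variable {D : Type} (Γ : TriGraph D)

/-- The first homology group `H₁(Γ, ℤ)`: antisymmetric functions on oriented edges whose
boundary vanishes at every vertex. -/
def cycles : Submodule ℤ (D → ℤ) where
  carrier := {z | (∀ d, z (Γ.inv d) = -z d) ∧
    ∀ d, Γ.rot d ≠ d → z d + z (Γ.rot d) + z (Γ.rot (Γ.rot d)) = 0}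
  zero_mem' := by simp
  add_mem' := by
    rintro a b ⟨ha, ha'⟩ ⟨hb, hb'⟩
    refine ⟨fun d => ?_, fun d hd => ?_⟩
    · simp only [Pi.add_apply, ha d, hb d]; ring
    · simp only [Pi.add_apply]; linarith [ha' d hd, hb' d hd]
  smul_mem' := by
    rintro c a ⟨ha, ha'⟩
    refine ⟨fun d => ?_, fun d hd => ?_⟩
    · simp only [Pi.smul_apply, ha d, smul_eq_mul]; ring
    · simp only [Pi.smul_apply, smul_eq_mul, ← mul_add, ha' d hd, mul_zero]

/-- The first cohomology group `H¹(Γ, ℤ) = Hom(H₁(Γ, ℤ), ℤ)`. -/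
abbrev H1 : Type := Module.Dual ℤ Γ.cycles

/-- The cohomology class of an oriented edge (its value on a cycle is the number of times that
the cycle runs through the edge). A leg attached to an edge stands for this class. -/
def edgeClass (d : D) : Γ.H1 := (LinearMap.proj d).comp Γ.cycles.subtype

end TriGraph

/-- A finite trivalent graph, bundled. -/
structure Diagram where
  Dart : Type
  [finite : Finite Dart]
  graph : TriGraph Dart

attribute [instance] Diagram.finite

/-- `H¹(Γ, ℤ)` as an object of the category of lattices. -/
def Diagram.coh (Γ : Diagram) : Lattice := ⟨Γ.graph.H1⟩

/-- The direct sum of the spaces `F (H¹(Γ, ℤ))` over all finite trivalent graphs. -/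
abbrev PreDiag (F : CModule) : Type 1 := DirectSum Diagram fun Γ => F.obj Γ.coh

/-- The graph `Γ` with decoration `x`. -/
def pre (F : CModule) {D : Type} [Finite D] (Γ : TriGraph D)
    (x : F.obj (Diagram.coh ⟨D, Γ⟩)) : PreDiag F :=
  DirectSum.lof ℚ Diagram (fun Γ => F.obj Γ.coh) ⟨D, Γ⟩ x

/-- The isomorphism `H¹(Γ', ℤ) ≃ H¹(Γ, ℤ)` dual to an isomorphism `H₁(Γ, ℤ) ≃ H₁(Γ', ℤ)`. -/
def cohMap {D D' : Type} [Finite D] [Finite D'] {Γ : TriGraph D} {Γ' : TriGraph D'}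
    (φ : Γ.cycles ≃ₗ[ℤ] Γ'.cycles) : Diagram.coh ⟨D', Γ'⟩ ⟶ Diagram.coh ⟨D, Γ⟩ :=
  (φ.dualMap : Γ'.H1 ≃ₗ[ℤ] Γ.H1)

/-- The defining relations of a space of diagrams. In each of them the isomorphism `φ` between
homology groups exists and is determined by the condition that it satisfies. -/
inductive Rel (F : CModule) : PreDiag F → Prop
  /-- Isomorphic graphs are identified. -/
  | iso {D D' : Type} [Finite D] [Finite D'] (Γ : TriGraph D) (Γ' : TriGraph D') (ψ : D ≃ D')
      (hinv : ∀ d, ψ (Γ.inv d) = Γ'.inv (ψ d)) (hrot : ∀ d, ψ (Γ.rot d) = Γ'.rot (ψ d))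
      (φ : Γ.cycles ≃ₗ[ℤ] Γ'.cycles) (hφ : ∀ z d, (φ z).1 (ψ d) = z.1 d)
      (x : F.obj (Diagram.coh ⟨D', Γ'⟩)) :
      Rel F (pre F Γ' x - pre F Γ (F.map (cohMap φ) x))
  /-- Reversing the orientation of the vertex that `d` leaves changes the sign. -/
  | antisymm {D : Type} [Finite D] (Γ Γ' : TriGraph D) (d : D)
      (hinv : Γ'.inv = Γ.inv) (hd : Γ.rot d ≠ d)
      (h₁ : ∀ t, t = d ∨ t = Γ.rot d ∨ t = Γ.rot (Γ.rot d) → Γ'.rot t = Γ.rot (Γ.rot t))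
      (h₂ : ∀ t, ¬ (t = d ∨ t = Γ.rot d ∨ t = Γ.rot (Γ.rot d)) → Γ'.rot t = Γ.rot t)
      (φ : Γ'.cycles ≃ₗ[ℤ] Γ.cycles) (hφ : ∀ z t, (φ z).1 t = z.1 t)
      (x : F.obj (Diagram.coh ⟨D, Γ⟩)) :
      Rel F (pre F Γ x + pre F Γ' (F.map (cohMap φ) x))
  /-- The relation between the three resolutions of a four-valent vertex with outgoing edges
  `a, b, c, e`, written in its cyclically symmetric (Jacobi) form; `d` is the new edge. -/
  | ihx {D : Type} [Finite D] (Γ₁ Γ₂ Γ₃ : TriGraph D) (d a b c e : D)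
      (hinv₂ : Γ₂.inv = Γ₁.inv) (hinv₃ : Γ₃.inv = Γ₁.inv)
      (hdist : [d, Γ₁.inv d, a, b, c, e].Nodup)
      (h₁ : Γ₁.rot d = a ∧ Γ₁.rot a = b ∧ Γ₁.rot b = d ∧
        Γ₁.rot (Γ₁.inv d) = c ∧ Γ₁.rot c = e ∧ Γ₁.rot e = Γ₁.inv d)
      (h₂ : Γ₂.rot d = b ∧ Γ₂.rot b = c ∧ Γ₂.rot c = d ∧
        Γ₂.rot (Γ₁.inv d) = a ∧ Γ₂.rot a = e ∧ Γ₂.rot e = Γ₁.inv d)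
      (h₃ : Γ₃.rot d = c ∧ Γ₃.rot c = a ∧ Γ₃.rot a = d ∧
        Γ₃.rot (Γ₁.inv d) = b ∧ Γ₃.rot b = e ∧ Γ₃.rot e = Γ₁.inv d)
      (hrest : ∀ t, t ∉ [d, Γ₁.inv d, a, b, c, e] →
        Γ₂.rot t = Γ₁.rot t ∧ Γ₃.rot t = Γ₁.rot t)
      (φ₂ : Γ₂.cycles ≃ₗ[ℤ] Γ₁.cycles)
      (hφ₂ : ∀ z t, t ≠ d → t ≠ Γ₁.inv d → (φ₂ z).1 t = z.1 t)
      (φ₃ : Γ₃.cycles ≃ₗ[ℤ] Γ₁.cycles)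
      (hφ₃ : ∀ z t, t ≠ d → t ≠ Γ₁.inv d → (φ₃ z).1 t = z.1 t)
      (x : F.obj (Diagram.coh ⟨D, Γ₁⟩)) :
      Rel F (pre F Γ₁ x + pre F Γ₂ (F.map (cohMap φ₂) x) + pre F Γ₃ (F.map (cohMap φ₃) x))

/-- The space `𝒟(F)` of diagrams decorated by `F`. -/
abbrev DiagSpace (F : CModule) : Type 1 := PreDiag F ⧸ Submodule.span ℚ {r | Rel F r}

/-- The class in `𝒟(F)` of the graph `Γ` with decoration `x`. -/
def diag (F : CModule) {D : Type} [Finite D] (Γ : TriGraph D)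
    (x : F.obj (Diagram.coh ⟨D, Γ⟩)) : DiagSpace F :=
  Submodule.Quotient.mk (pre F Γ x)

/-- The map of direct sums induced by a natural transformation. -/
def preMap {F G : CModule} (η : F ⟶ G) : PreDiag F →ₗ[ℚ] PreDiag G :=
  DirectSum.toModule ℚ Diagram (PreDiag G) fun Γ =>
    (DirectSum.lof ℚ Diagram (fun Γ => G.obj Γ.coh) Γ).comp (η.app Γ.coh).hom

theorem preMap_pre {F G : CModule} (η : F ⟶ G) {D : Type} [Finite D] (Γ : TriGraph D)
    (x : F.obj (Diagram.coh ⟨D, Γ⟩)) :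
    preMap η (pre F Γ x) = pre G Γ (η.app _ x) := by
  simp [preMap, pre, DirectSum.toModule_lof]

theorem app_map {F G : CModule} (η : F ⟶ G) {A B : Lattice} (u : A ⟶ B) (x : F.obj A) :
    η.app B (F.map u x) = G.map u (η.app A x) := by
  simp

theorem preMap_rel {F G : CModule} (η : F ⟶ G) {r : PreDiag F} (h : Rel F r) :
    Rel G (preMap η r) := by
  cases h with
  | iso Γ Γ' ψ hinv hrot φ hφ x =>
    rw [map_sub, preMap_pre, preMap_pre, app_map]
    exact .iso Γ Γ' ψ hinv hrot φ hφ _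
  | antisymm Γ Γ' d hinv hd h₁ h₂ φ hφ x =>
    rw [map_add, preMap_pre, preMap_pre, app_map]
    exact .antisymm Γ Γ' d hinv hd h₁ h₂ φ hφ _
  | ihx Γ₁ Γ₂ Γ₃ d a b c e hinv₂ hinv₃ hdist h₁ h₂ h₃ hrest φ₂ hφ₂ φ₃ hφ₃ x =>
    rw [map_add, map_add, preMap_pre, preMap_pre, preMap_pre, app_map, app_map]
    exact .ihx Γ₁ Γ₂ Γ₃ d a b c e hinv₂ hinv₃ hdist h₁ h₂ h₃ hrest φ₂ hφ₂ φ₃ hφ₃ _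

/-- The functoriality of `𝒟`. -/
def diagMap {F G : CModule} (η : F ⟶ G) : DiagSpace F →ₗ[ℚ] DiagSpace G :=
  Submodule.mapQ _ _ (preMap η) <| by
    rw [Submodule.span_le]
    exact fun r hr => Submodule.subset_span (preMap_rel η hr)

/-- The space `ℬ` of (completed) uni-trivalent diagrams, `ℬ = 𝒟(ℚ[[H]])`. -/
abbrev SpaceB : Type 1 := DiagSpace psFunctor

/-- The space `ℬ_s = 𝒟((H \ {0})⁻¹ ℚ[[H]])` of diagrams with singular colorings. -/
abbrev SpaceBs : Type 1 := DiagSpace locFunctor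

/-- The localization map `ℬ → ℬ_s`. -/
def localize : SpaceB →ₗ[ℚ] SpaceBs := diagMap locTrans

/-! ### Gluing graphs and their substitution -/

/-- An unoriented graph with vertex set `V`; loops and multiple edges are allowed.
`B` is the set of half-edges: the edges are the pairs `{b, opp b}` and `b` is attached to the
vertex `base b`. -/
structure GluingGraph (V B : Type) where
  opp : B → B
  opp_opp : ∀ b, opp (opp b) = b
  opp_ne : ∀ b, opp b ≠ b
  base : B → V

namespace GluingGraph

variable {V B : Type} (X : GluingGraph V B)

/-- The valency of a vertex (a loop counts twice). -/
def valency (v : V) : ℕ := Nat.card {b : B // X.base b = v}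

/-- The simple graph underlying a gluing graph. -/
def toSimple : SimpleGraph V where
  Adj u v := u ≠ v ∧ ∃ b, X.base b = u ∧ X.base (X.opp b) = v
  symm := ⟨by
    rintro u v ⟨h, b, hb, hb'⟩
    exact ⟨h.symm, X.opp b, hb', by rw [X.opp_opp]; exact hb⟩⟩
  loopless := ⟨fun u h => h.1 rfl⟩

/-- A gluing graph is connected. -/
def Connected : Prop := X.toSimple.Connected

/-- A gluing graph is a tree: it has no loop, no multiple edge, and is a tree as a simple graph. -/
def IsTree : Prop :=
  (∀ b, X.base (X.opp b) ≠ X.base b) ∧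
  (∀ b b', X.base b = X.base b' → X.base (X.opp b) = X.base (X.opp b') → b = b') ∧
  X.toSimple.IsTree

/-- The vertices without edges. -/
abbrev Isolated : Type := {v : V // ∀ b, X.base b ≠ v}

/-- A choice, at every vertex, of a cyclic ordering of the half-edges attached to it, given as the
permutation that sends a half-edge to the next one at its vertex. -/
abbrev CyclicOrdering : Type :=
  {σ : Equiv.Perm B // ∀ b b', σ.SameCycle b b' ↔ X.base b = X.base b'}

/-- The oriented edges of the graph obtained by inserting circles at the vertices. -/
inductive CircleDart : Type
  /-- the edge of the gluing graph that contains the half-edge `b`, leaving the circle -/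
  | edge (b : B)
  /-- the arc of circle that starts at the end of `b`, run forward -/
  | fwd (b : B)
  /-- the arc of circle that ends at the end of `b`, run backward -/
  | bwd (b : B)
  /-- the circle inserted at an isolated vertex, with one of its two orientations -/
  | ring (v : X.Isolated) (o : Bool)

instance [Finite V] [Finite B] : Finite X.CircleDart := by
  refine Finite.of_injective (β := (B ⊕ B ⊕ B) ⊕ (X.Isolated × Bool))
    (fun t => match t with
      | .edge b => .inl (.inl b)
      | .fwd b => .inl (.inr (.inl b))
      | .bwd b => .inl (.inr (.inr b))
      | .ring v o => .inr (v, o)) ?_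
  rintro (_ | _ | _ | _) (_ | _ | _ | _) h <;> simp_all

/-- The trivalent graph obtained by gluing, at every vertex, the incoming edges to a circle in a
prescribed cyclic order. The circles are planar and oriented, with their edges outside. -/
def circleGraph (σ : X.CyclicOrdering) : TriGraph X.CircleDart where
  inv
    | .edge b => .edge (X.opp b)
    | .fwd b => .bwd (σ.1 b)
    | .bwd b => .fwd (σ.1.symm b)
    | .ring v o => .ring v (!o)
  rot
    | .edge b => .fwd b
    | .fwd b => .bwd b
    | .bwd b => .edge b
    | .ring v o => .ring v o
  inv_inv := by rintro (_ | _ | _ | _) <;> simp [X.opp_opp]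
  inv_ne := by rintro (_ | _ | _ | _) <;> simp [X.opp_ne]
  rot_rot_rot := by rintro (_ | _ | _ | _) <;> rfl
  rot_inv := by rintro (_ | _ | _ | _) <;> simp

/-- The arcs of the circles: the arc that follows each half-edge, and the full circles at isolated
vertices. -/
abbrev Arc : Type := B ⊕ X.Isolated

/-- The cohomology class of an arc. -/
def arcClass (σ : X.CyclicOrdering) : X.Arc → (X.circleGraph σ).H1
  | .inl b => (X.circleGraph σ).edgeClass (.fwd b)
  | .inr v => (X.circleGraph σ).edgeClass (.ring v true)

/-- The vertex at which an arc lies. -/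
def arcBase : X.Arc → V
  | .inl b => X.base b
  | .inr v => v.1

/-- The order of the wheel at `v` when the arc `a` of the glued diagram carries `m a` free legs:
every other leg of the wheel is glued to a half-edge. -/
def wheelOrder [Fintype V] [Fintype B] (m : X.Arc →₀ ℕ) (v : V) : ℕ :=
  X.valency v + ∑ a : X.Arc, if X.arcBase a = v then m a else 0

/-- The ways of gluing the half-edges at each vertex `v` to distinct legs of a wheel with `n v` legs;
the legs are numbered in their cyclic order by `0, …, n v - 1`. -/
abbrev Gluing (n : V → ℕ) : Type := ∀ v, {b : B // X.base b = v} ↪ Fin (n v)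

/-- Going around the wheels after a gluing, one finds, after the leg glued to `b`, exactly `m b`
free legs, and then the leg glued to `σ b`. -/
def Induces {n : V → ℕ} (g : X.Gluing n) (σ : X.CyclicOrdering) (m : B → ℕ) : Prop :=
  ∀ v (b b' : {b : B // X.base b = v}),
    (σ.1 b = b' → ((g v b : ℕ) + m b + 1) % n v = g v b') ∧
    ∀ j < m b, ((g v b : ℕ) + j + 1) % n v ≠ g v b'

/-- The sum over all gluings, to all wheels of the series `f v = ∑ₙ aₙ xⁿ`, that lead to a given
cyclic ordering `σ`. A gluing with `m a` free legs on each arc `a` contributes the monomial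
`∏ a, a ^ m a`, with the product of the coefficients of the wheels. -/
def gluingSeries [Fintype V] [Fintype B] (σ : X.CyclicOrdering) (f : V → PowerSeries ℚ) :
    MvPowerSeries X.Arc ℚ := fun m =>
  ∑ g : X.Gluing (X.wheelOrder m),
    if X.Induces g σ (fun b => m (.inl b))
      then ∏ v, PowerSeries.coeff (X.wheelOrder m v) (f v) else 0

/-- The substitution `s(X) ∈ ℬ` of a gluing graph whose vertices carry the series `f v`: the sum of
all diagrams obtained by gluing the edges at each vertex to legs of the wheels generated by
its series. The free legs of an arc are turned into the class of this arc. -/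
def substitution [Fintype V] [Fintype B] (f : V → PowerSeries ℚ) : SpaceB :=
  ∑ σ : X.CyclicOrdering,
    diag psFunctor (X.circleGraph σ) (evalSeries (X.arcClass σ) (X.gluingSeries σ f))

end GluingGraph

/-! ### Decorations -/

section Decorations

variable {H : Type} [AddCommGroup H] [Module.Free ℤ H] [Module.Finite ℤ H]

/-- A class of `H` as an element of `(H \ {0})⁻¹ ℚ[[H]]`. -/
def linLoc (y : H) : LocRing H := algebraMap (PSRing H) (LocRing H) (lin y)

/-- The value `f(y)` of a power series at a class `y`. -/
def evalAt (y : H) (f : PowerSeries ℚ) : LocRing H :=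
  algebraMap (PSRing H) (LocRing H) (PowerSeries.subst (lin y) f)

/-- The value `f(y)` of a Laurent series at a nonzero class `y`. -/
def evalLaurentAt (y : H) (f : LaurentSeries ℚ) : LocRing H :=
  linLoc y ^ f.order.toNat * Ring.inverse (linLoc y) ^ (-f.order).toNat *
    evalAt y f.powerSeriesPart

/-- The inverse of a product of nonzero linear terms. -/
def invProd (D : Multiset H) : LocRing H := Ring.inverse (D.map linLoc).prod

/-- `f⁽ᵏ⁻ᵖ⁾(y)`. -/
def derivTerm (f : PowerSeries ℚ) (k p : ℕ) (y : H) : LocRing H :=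
  evalAt y ((PowerSeries.derivative ℚ)^[k - p] f)

/-- `yᵖ · (f'(y) / yᵖ)⁽ᵏ⁻ᵖ⁻¹⁾` if `0 < k` (for `p < k`), and `f(y)` if `k = 0`. -/
def laurentTerm (f : PowerSeries ℚ) (k p : ℕ) (y : H) : LocRing H :=
  if k = 0 then evalAt y f
  else linLoc y ^ p * evalLaurentAt y ((LaurentSeries.derivative ℚ)^[k - p - 1]
    (((PowerSeries.derivative ℚ f : PowerSeries ℚ) : LaurentSeries ℚ) *
      HahnSeries.single (-(p : ℤ)) 1))

end Decorations

/-- One diagram in the formula for a substitution: edges glued to circles in the cyclic orders `σ`,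
and for each vertex `v` a class `y v`, a number `p v` and the factors `den v` of a denominator. -/
structure Term {V B : Type} (X : GluingGraph V B) where
  σ : X.CyclicOrdering
  y : V → (X.circleGraph σ).H1
  p : V → ℕ
  den : V → Multiset (X.circleGraph σ).H1

/-- The classes are nonzero, `0 ≤ p ≤ k - 1` (and `p = 0` if `k = 0`), where `k` is the valency, and
each denominator is a product of `p` nonzero linear terms. -/
def Term.Valid {V B : Type} [Finite V] [Finite B] {X : GluingGraph V B} (T : Term X) : Prop :=
  ∀ v, T.y v ≠ 0 ∧ (T.p v = 0 ∨ T.p v < X.valency v) ∧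
    (T.den v).card = T.p v ∧ ∀ h ∈ T.den v, h ≠ 0

/-- The diagram in `ℬ_s` with the decoration `∏ v, f⁽ᵏ⁻ᵖ⁾(y) / D`. -/
def Term.derivDiagram {V B : Type} [Fintype V] [Fintype B] {X : GluingGraph V B} (T : Term X)
    (f : V → PowerSeries ℚ) : SpaceBs :=
  diag locFunctor (X.circleGraph T.σ)
    (∏ v, derivTerm (f v) (X.valency v) (T.p v) (T.y v) * invProd (T.den v) :
      LocRing (X.circleGraph T.σ).H1)

/-- The diagram in `ℬ_s` with the decoration `∏ v, yᵖ (f'(y) / yᵖ)⁽ᵏ⁻ᵖ⁻¹⁾ / D`. -/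
def Term.laurentDiagram {V B : Type} [Fintype V] [Fintype B] {X : GluingGraph V B} (T : Term X)
    (f : V → PowerSeries ℚ) : SpaceBs :=
  diag locFunctor (X.circleGraph T.σ)
    (∏ v, laurentTerm (f v) (X.valency v) (T.p v) (T.y v) * invProd (T.den v) :
      LocRing (X.circleGraph T.σ).H1)

end GluingDiagrams

end

open GluingDiagrams

/-!
A substitution is already a sum over the cyclic orderings `σ`, and after localization the
decoration of each diagram `X.circleGraph σ` can be rewritten in its coefficient ring alone; no
relation between different graphs is needed.

Fix `σ`, and let `x₁, …, xₖ` be the classes of the arcs of the circle at a vertex `v` of valency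
`k > 0`. A gluing that leaves prescribed gaps is determined by the leg glued to one half-edge, so
that there are `n` such gluings to a wheel with `n` legs (`card_cyclic_gluings`). Hence the wheels
at `v` contribute `∑ n aₙ h_{n-k}(x₁, …, xₖ)`, with `h` the complete homogeneous symmetric
polynomials. This is the divided difference `f'[x₁, …, xₖ]` (`gluingSeries_eq`). At a vertex of
valency zero it is `f(x)`.

The recursion `(xᵢ - xⱼ) f'[x₁, …, xₖ] = f'[…, x̂ⱼ, …] - f'[…, x̂ᵢ, …]` divides by the nonzero
class `xᵢ - xⱼ` as long as two classes differ, and for equal classes the divided difference is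
`f⁽ᵏ⁾(y) / (k - 1)!`. This yields the fractions `f⁽ᵏ⁻ᵖ⁾(y) / D`, with `p > 0` as soon as two of
the classes differ (`dividedDifferenceMap_mem_span`). The passage to the Laurent form is
triangular in the order of the derivative (`exists_laurentTerm_eq`,
`span_vertexMaps_derivTerm_le`).

An arc lies on the cycle around its circle, so its class is nonzero. The class of an edge is, up
to sign, the difference of two consecutive arcs. If at every vertex all arcs have the same class,
then the edges have class zero, so the gluing graph carries no nonzero flow and is a tree
(`isTree_of_arcClass_eq`).

Uniformity in the series `f` is obtained by working in spaces of functions of `f`: the assertion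
is that `f ↦ localize (X.substitution f)` lies in a span (`localize_substitution_mem_span`). -/

open scoped Classical

noncomputable section

namespace GluingDiagrams

/-! ### Divided differences of power series -/

section DividedDifferences

variable {ι : Type} [Fintype ι]

/-- The divided difference of the series `g = ∑ gₙ xⁿ` at the variables in `s`, which is `∑ gₙ
h_{n + 1 - k}(s)` where `k` is the number of variables and `h` denotes the complete homogeneous
symmetric polynomials. For `s = ∅` the formula has no meaning; only nonempty `s` are used. -/
def dividedDifference (s : Finset ι) (g : PowerSeries ℚ) : MvPowerSeries ι ℚ := fun m =>
  if m.support ⊆ s then PowerSeries.coeff (m.degree + (s.card - 1)) g else 0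

omit [Fintype ι] in
theorem coeff_dividedDifference (s : Finset ι) (g : PowerSeries ℚ) (m : ι →₀ ℕ) :
    MvPowerSeries.coeff m (dividedDifference s g) =
      if m.support ⊆ s then PowerSeries.coeff (m.degree + (s.card - 1)) g else 0 := rfl

omit [Fintype ι] in
theorem coeff_X_mul_dividedDifference {s : Finset ι} {a : ι} (ha : a ∈ s) (hs : 1 < s.card)
    (g : PowerSeries ℚ) (m : ι →₀ ℕ) :
    MvPowerSeries.coeff m (MvPowerSeries.X a * dividedDifference s g) =
      if m.support ⊆ s ∧ m a ≠ 0 then PowerSeries.coeff (m.degree + (s.card - 2)) g else 0 := by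
  rw [MvPowerSeries.X, MvPowerSeries.coeff_monomial_mul, one_mul, coeff_dividedDifference]
  by_cases hm : m a = 0
  · rw [if_neg, if_neg (by simp [hm])]
    rw [Finsupp.single_le_iff]; omega
  · have hle : Finsupp.single a 1 ≤ m := by
      rw [Finsupp.single_le_iff]; omega
    obtain ⟨m, rfl⟩ := exists_add_of_le hle
    rw [if_pos hle, add_tsub_cancel_left]
    have h1 : (Finsupp.single a 1 + m).support ⊆ s ↔ m.support ⊆ s := by
      rw [Finsupp.support_add_eq_union]
      · rw [Finset.union_subset_iff, Finsupp.support_single _ one_ne_zero]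
        simp [ha]
    simp only [h1, hm, ne_eq, not_false_eq_true, and_true]
    have h2 : (Finsupp.single a 1 + m).degree + (s.card - 2) = m.degree + (s.card - 1) := by
      rw [map_add, Finsupp.degree_single]; omega
    rw [h2]

omit [Fintype ι] in
/-- The recursion of divided differences. A monomial of the left side survives if exactly one of
`a`, `b` divides it, and then it is the monomial of one of the two terms on the right. -/
theorem X_sub_X_mul_dividedDifference {s : Finset ι} {a b : ι} (ha : a ∈ s) (hb : b ∈ s)
    (hab : a ≠ b) (g : PowerSeries ℚ) :
    (MvPowerSeries.X a - MvPowerSeries.X b) * dividedDifference s g =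
      dividedDifference (s.erase b) g - dividedDifference (s.erase a) g := by
  have hs : 1 < s.card := Finset.one_lt_card.2 ⟨a, ha, b, hb, hab⟩
  ext m
  rw [sub_mul, map_sub, map_sub, coeff_X_mul_dividedDifference ha hs,
    coeff_X_mul_dividedDifference hb hs, coeff_dividedDifference, coeff_dividedDifference,
    Finset.card_erase_of_mem ha, Finset.card_erase_of_mem hb, Nat.sub_sub]
  have key : ∀ c, (m.support ⊆ s.erase c) ↔ m.support ⊆ s ∧ m c = 0 := fun c => by
    rw [Finset.subset_erase, Finsupp.notMem_support_iff]
  simp only [key]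
  by_cases h : m.support ⊆ s <;> by_cases h1 : m a = 0 <;> by_cases h2 : m b = 0 <;>
    simp [h, h1, h2]

/-- Equal variables turn a divided difference into a derivative: the number of monomials of
degree `n` in `s.card` variables is a binomial coefficient. -/
theorem subst_X_dividedDifference {s : Finset ι} (hs : s.Nonempty) (g : PowerSeries ℚ) :
    MvPowerSeries.subst (fun _ => (PowerSeries.X : PowerSeries ℚ)) (dividedDifference s g) =
      ((s.card - 1).factorial : ℚ)⁻¹ • (PowerSeries.derivative ℚ)^[s.card - 1] g := by
  have hX : MvPowerSeries.HasSubst (fun _ : ι => (PowerSeries.X : PowerSeries ℚ)) :=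
    MvPowerSeries.hasSubst_of_constantCoeff_zero fun _ => PowerSeries.constantCoeff_X
  ext n
  have hprod : ∀ d : ι →₀ ℕ, (d.prod fun _ e => (PowerSeries.X : PowerSeries ℚ) ^ e) =
      PowerSeries.X ^ d.degree := fun d => by
    rw [Finsupp.prod, Finset.prod_pow_eq_pow_sum, Finsupp.degree_apply]
  have hterm : ∀ d : ι →₀ ℕ, MvPowerSeries.coeff d (dividedDifference s g) •
      PowerSeries.coeff n (d.prod fun _ e => (PowerSeries.X : PowerSeries ℚ) ^ e) =
      if d ∈ s.finsuppAntidiag n then PowerSeries.coeff (n + (s.card - 1)) g else 0 := fun d => by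
    simp only [hprod, PowerSeries.coeff_X_pow, coeff_dividedDifference, Finset.mem_finsuppAntidiag]
    by_cases h : d.support ⊆ s
    · simp only [h, and_true, if_true]
      have hd : d.degree = s.sum d := by
        rw [Finsupp.degree_apply]
        exact Finset.sum_subset h fun i _ hi => Finsupp.notMem_support_iff.1 hi
      by_cases hn : s.sum d = n
      · simp [hd, hn]
      · simp [hd, hn, Ne.symm hn]
    · simp [h]
  refine (MvPowerSeries.coeff_subst hX _ _).trans ?_
  refine (finsum_congr hterm).trans ?_
  rw [finsum_eq_sum_of_support_subset (s := s.finsuppAntidiag n)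
    (fun d => if d ∈ s.finsuppAntidiag n then PowerSeries.coeff (n + (s.card - 1)) g else 0)]
  · rw [Finset.sum_ite_mem, Finset.inter_self, Finset.sum_const,
      Finset.card_finsuppAntidiag_nat_eq_choose, PowerSeries.coeff_smul,
      PowerSeries.coeff_iterate_derivative, Nat.ascFactorial_eq_factorial_mul_choose]
    have hk := hs.card_pos
    have h1 : s.card + n - 1 = n + (s.card - 1) := by omega
    have hf : ((s.card - 1).factorial : ℚ) ≠ 0 := by exact_mod_cast Nat.factorial_ne_zero _
    rw [h1, Nat.choose_symm_add, nsmul_eq_mul, smul_eq_mul, Nat.cast_mul]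
    field_simp
  · intro d hd
    by_contra h
    exact hd (if_neg h)

variable {H : Type} [AddCommGroup H] [Module.Free ℤ H] [Module.Finite ℤ H]

theorem evalSeries_dividedDifference_congr {s : Finset ι} {x x' : ι → H}
    (h : ∀ i ∈ s, x i = x' i) (g : PowerSeries ℚ) :
    evalSeries x (dividedDifference s g) = evalSeries x' (dividedDifference s g) := by
  simp only [evalSeries, MvPowerSeries.substAlgHom_apply]
  ext e
  rw [MvPowerSeries.coeff_subst (hasSubst_lin x), MvPowerSeries.coeff_subst (hasSubst_lin x')]
  refine finsum_congr fun d => ?_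
  rw [coeff_dividedDifference]
  by_cases hd : d.support ⊆ s
  · congr 2
    exact Finsupp.prod_congr fun i hi => by rw [h i (hd hi)]
  · simp [hd]

theorem hasSubst_lin_powerSeries (y : H) : PowerSeries.HasSubst (lin y) :=
  PowerSeries.HasSubst.of_constantCoeff_zero (constantCoeff_lin y)

theorem evalSeries_dividedDifference_of_eq {s : Finset ι} (hs : s.Nonempty) {x : ι → H} {y : H}
    (h : ∀ i ∈ s, x i = y) (g : PowerSeries ℚ) :
    evalSeries x (dividedDifference s g) = ((s.card - 1).factorial : ℚ)⁻¹ •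
      PowerSeries.subst (lin y) ((PowerSeries.derivative ℚ)^[s.card - 1] g) := by
  have hX : MvPowerSeries.HasSubst (fun _ : ι => (PowerSeries.X : PowerSeries ℚ)) :=
    MvPowerSeries.hasSubst_of_constantCoeff_zero fun _ => PowerSeries.constantCoeff_X
  rw [evalSeries_dividedDifference_congr (x' := fun _ => y) h,
    ← PowerSeries.subst_smul (hasSubst_lin_powerSeries y), ← subst_X_dividedDifference hs,
    PowerSeries.subst, MvPowerSeries.subst_comp_subst_apply hX (hasSubst_lin_powerSeries y).const]
  simp only [evalSeries, MvPowerSeries.substAlgHom_apply]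
  congr 1
  funext i
  exact (PowerSeries.subst_X (hasSubst_lin_powerSeries y)).symm

end DividedDifferences

/-! ### Evaluation of power series and Laurent series at a class -/

section Laurent

variable {H : Type} [AddCommGroup H] [Module.Free ℤ H] [Module.Finite ℤ H]

theorem evalAt_add (y : H) (f g : PowerSeries ℚ) : evalAt y (f + g) = evalAt y f + evalAt y g := by
  rw [evalAt, PowerSeries.subst_add (hasSubst_lin_powerSeries y), map_add, evalAt, evalAt]

theorem evalAt_mul (y : H) (f g : PowerSeries ℚ) : evalAt y (f * g) = evalAt y f * evalAt y g := by
  rw [evalAt, PowerSeries.subst_mul (hasSubst_lin_powerSeries y), map_mul, evalAt, evalAt]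

theorem evalAt_smul (y : H) (c : ℚ) (f : PowerSeries ℚ) : evalAt y (c • f) = c • evalAt y f := by
  rw [evalAt, PowerSeries.subst_smul (hasSubst_lin_powerSeries y), evalAt,
    Algebra.algebraMap_eq_smul_one, Algebra.algebraMap_eq_smul_one, smul_assoc]

theorem evalAt_X_pow (y : H) (n : ℕ) : evalAt y (PowerSeries.X ^ n) = linLoc y ^ n := by
  rw [evalAt, PowerSeries.subst_pow (hasSubst_lin_powerSeries y),
    PowerSeries.subst_X (hasSubst_lin_powerSeries y), map_pow, linLoc]

theorem isUnit_linLoc {y : H} (hy : y ≠ 0) : IsUnit (linLoc y) :=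
  IsLocalization.map_units (LocRing H)
    (⟨lin y, Submonoid.subset_closure ⟨y, hy, rfl⟩⟩ : linMonoid H)

/-- A Laurent series written with a denominator `xⁿ` that need not be the exact pole order is
evaluated as expected. -/
theorem evalLaurentAt_mul_single {y : H} (hy : y ≠ 0) (g : PowerSeries ℚ) (n : ℕ) :
    evalLaurentAt y ((g : LaurentSeries ℚ) * HahnSeries.single (-(n : ℤ)) 1) =
      evalAt y g * Ring.inverse (linLoc y) ^ n := by
  set F : LaurentSeries ℚ := (g : LaurentSeries ℚ) * HahnSeries.single (-(n : ℤ)) 1 with hF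
  have hu : linLoc y * Ring.inverse (linLoc y) = 1 := Ring.mul_inverse_cancel _ (isUnit_linLoc hy)
  have hg : (g : LaurentSeries ℚ) = HahnSeries.single (F.order + n) 1 *
      (F.powerSeriesPart : LaurentSeries ℚ) := by
    have h1 : (g : LaurentSeries ℚ) = HahnSeries.single (n : ℤ) 1 * F := by
      rw [hF, mul_left_comm, HahnSeries.single_mul_single]
      simp
    rw [h1]
    conv_lhs => rw [← LaurentSeries.single_order_mul_powerSeriesPart F]
    rw [← mul_assoc, HahnSeries.single_mul_single, one_mul, add_comm]
  by_cases hF0 : F = 0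
  · have : g = 0 := by
      have : (g : LaurentSeries ℚ) = 0 := by rw [hg, hF0]; simp
      exact HahnSeries.ofPowerSeries_injective (Γ := ℤ) (by simpa using this)
    rw [hF0, this, evalLaurentAt, LaurentSeries.powerSeriesPart_zero]
    have : evalAt y (0 : PowerSeries ℚ) = 0 := by simpa using evalAt_smul y 0 0
    rw [this, mul_zero, zero_mul]
  have hnonneg : 0 ≤ F.order + n := by
    by_contra hneg
    have h0 : F.coeff F.order = 0 := by
      have h1 : F.order = (F.order + n) + (-(n : ℤ)) := by ring
      rw [h1]
      conv_lhs => rw [hF]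
      rw [HahnSeries.coeff_mul_single_add, PowerSeries.coeff_coe, if_pos (not_le.1 hneg), zero_mul]
    exact hF0 (HahnSeries.coeff_order_eq_zero.1 h0)
  obtain ⟨j, hj⟩ := Int.eq_ofNat_of_zero_le hnonneg
  have hg' : g = PowerSeries.X ^ j * F.powerSeriesPart := by
    apply HahnSeries.ofPowerSeries_injective (Γ := ℤ)
    rw [hg, map_mul, HahnSeries.ofPowerSeries_X_pow, hj]
  rw [hg', evalAt_mul, evalAt_X_pow, evalLaurentAt,
    mul_right_comm (linLoc y ^ j)]
  congr 1
  set u := linLoc y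
  set w := Ring.inverse u
  have huw : ∀ k : ℕ, u ^ k * w ^ k = 1 := fun k => by rw [← mul_pow, hu, one_pow]
  -- The two exponents in the definition of `evalLaurentAt` are never both positive.
  rcases le_total 0 F.order with ho | ho
  · obtain ⟨o, ho⟩ := Int.eq_ofNat_of_zero_le ho
    have hjo : j = o + n := by omega
    have h1 : F.order.toNat = o := by omega
    have h2 : (-F.order).toNat = 0 := by omega
    rw [h1, h2, hjo, pow_zero, mul_one, pow_add, mul_assoc, huw, mul_one]
  · have h1 : F.order.toNat = 0 := by omega
    have hn : n = j + (-F.order).toNat := by omega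
    rw [h1, pow_zero, one_mul]
    conv_rhs => rw [hn, pow_add, ← mul_assoc, huw, one_mul]

/-- The quotient rule `(g / xⁿ)' = (x g' - n g) / xⁿ⁺¹`. -/
theorem derivative_mul_single (g : PowerSeries ℚ) (n : ℕ) :
    LaurentSeries.derivative ℚ ((g : LaurentSeries ℚ) * HahnSeries.single (-(n : ℤ)) 1) =
      ((PowerSeries.X * PowerSeries.derivative ℚ g - (n : ℚ) • g : PowerSeries ℚ) :
        LaurentSeries ℚ) * HahnSeries.single (-((n + 1 : ℕ) : ℤ)) 1 := by
  ext i
  obtain ⟨a, rfl⟩ : ∃ a : ℤ, i = a + (-((n + 1 : ℕ) : ℤ)) := ⟨i + (n + 1 : ℕ), by ring⟩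
  rw [HahnSeries.coeff_mul_single_add, LaurentSeries.derivative_apply,
    LaurentSeries.hasseDeriv_coeff]
  have h1 : a + (-((n + 1 : ℕ) : ℤ)) + (1 : ℕ) = a + (-(n : ℤ)) := by push_cast; ring
  rw [h1, HahnSeries.coeff_mul_single_add, Ring.choose_one_right, PowerSeries.coeff_coe,
    PowerSeries.coeff_coe]
  split_ifs with ha
  · simp
  obtain ⟨k, rfl⟩ := Int.eq_ofNat_of_zero_le (not_lt.1 ha)
  rw [map_sub, PowerSeries.coeff_smul]
  have h2 : PowerSeries.coeff k (PowerSeries.X * PowerSeries.derivative ℚ g) =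
      k * PowerSeries.coeff k g := by
    cases k with
    | zero => simp
    | succ k => rw [PowerSeries.coeff_succ_X_mul, PowerSeries.coeff_derivative]; push_cast; ring
  simp only [Int.natAbs_natCast, h2, mul_one, smul_eq_mul, zsmul_eq_mul]
  push_cast
  ring

/-- The numerator of the `l`-th derivative of `g / xᵖ` over the denominator `x ^ (p + l)`. -/
def laurentNumerator (p : ℕ) (g : PowerSeries ℚ) : ℕ → PowerSeries ℚ
  | 0 => g
  | l + 1 => PowerSeries.X * PowerSeries.derivative ℚ (laurentNumerator p g l) -
      ((p + l : ℕ) : ℚ) • laurentNumerator p g l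

theorem iterate_derivative_mul_single (p : ℕ) (g : PowerSeries ℚ) (l : ℕ) :
    (LaurentSeries.derivative ℚ)^[l] ((g : LaurentSeries ℚ) * HahnSeries.single (-(p : ℤ)) 1) =
      (laurentNumerator p g l : LaurentSeries ℚ) * HahnSeries.single (-((p + l : ℕ) : ℤ)) 1 := by
  induction l with
  | zero => rfl
  | succ l ih => rw [Function.iterate_succ_apply', ih, derivative_mul_single]; rfl

/-- The leading coefficient `1` is what makes the comparison of derivatives with Laurent
derivatives triangular. -/
theorem exists_laurentNumerator_eq (p l : ℕ) : ∃ c : ℕ → ℚ, c l = 1 ∧ ∀ g : PowerSeries ℚ,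
    laurentNumerator p g l = ∑ i ∈ Finset.range (l + 1),
      c i • (PowerSeries.X ^ i * (PowerSeries.derivative ℚ)^[i] g) := by
  induction l with
  | zero => exact ⟨fun _ => 1, rfl, fun g => by simp [laurentNumerator]⟩
  | succ l ih =>
    obtain ⟨c, hc, h⟩ := ih
    refine ⟨fun i => (if i < l + 1 then c i * ((i : ℚ) - (p + l : ℕ)) else 0) +
      if i = 0 then 0 else c (i - 1), by simp [hc], fun g => ?_⟩
    set T : ℕ → PowerSeries ℚ := fun i => PowerSeries.X ^ i * (PowerSeries.derivative ℚ)^[i] g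
      with hT
    have hT' : ∀ i, PowerSeries.X * PowerSeries.derivative ℚ (T i) = (i : ℚ) • T i + T (i + 1) := by
      intro i
      simp only [hT]
      rw [Derivation.leibniz, Derivation.leibniz_pow, PowerSeries.derivative_X,
        Function.iterate_succ_apply']
      cases i with
      | zero => simp
      | succ i => rw [Nat.cast_smul_eq_nsmul, nsmul_eq_mul]; simp [pow_succ]; ring
    have e1 : ∑ i ∈ Finset.range (l + 1 + 1),
        (if i < l + 1 then c i * ((i : ℚ) - (p + l : ℕ)) else 0) • T i =
        ∑ i ∈ Finset.range (l + 1), (c i * ((i : ℚ) - (p + l : ℕ))) • T i := by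
      rw [Finset.sum_range_succ, if_neg (lt_irrefl _), zero_smul, add_zero]
      exact Finset.sum_congr rfl fun i hi => by rw [if_pos (Finset.mem_range.1 hi)]
    have e2 : ∑ i ∈ Finset.range (l + 1 + 1), (if i = 0 then 0 else c (i - 1)) • T i =
        ∑ i ∈ Finset.range (l + 1), c i • T (i + 1) := by
      rw [Finset.sum_range_succ']
      simp
    simp only [add_smul, Finset.sum_add_distrib]
    rw [e1, e2, laurentNumerator, h, map_sum, Finset.mul_sum, Finset.smul_sum,
      ← Finset.sum_sub_distrib, ← Finset.sum_add_distrib]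
    refine Finset.sum_congr rfl fun i _ => ?_
    rw [Derivation.map_smul, mul_smul_comm, hT']
    module

end Laurent

/-! ### The space spanned by the factors at a vertex -/

section VertexTerms

variable {H : Type} [AddCommGroup H] [Module.Free ℤ H] [Module.Finite ℤ H]

theorem linLoc_sub (y z : H) : linLoc (y - z) = linLoc y - linLoc z := by
  have h : lin y = lin (y - z) + lin z := by rw [← lin_add, sub_add_cancel]
  rw [linLoc, linLoc, linLoc, h, map_add, add_sub_cancel_right]

theorem invProd_add (D D' : Multiset H) : invProd (D + D') = invProd D * invProd D' := by
  rw [invProd, Multiset.map_add, Multiset.prod_add, Ring.mul_inverse_rev, mul_comm, invProd,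
    invProd]

theorem invProd_replicate (n : ℕ) (y : H) :
    invProd (Multiset.replicate n y) = Ring.inverse (linLoc y) ^ n := by
  rw [invProd, Multiset.map_replicate, Multiset.prod_replicate, Ring.inverse_pow]

theorem invProd_cons (y : H) (D : Multiset H) :
    invProd (y ::ₘ D) = invProd D * Ring.inverse (linLoc y) := by
  rw [← Multiset.singleton_add, add_comm, invProd_add, ← Multiset.replicate_one,
    invProd_replicate, pow_one]

theorem invProd_zero : invProd (0 : Multiset H) = 1 := by simp [invProd]

variable (H) in
/-- The maps `g ↦ g⁽ˡ⁾(y) / D` with `y ≠ 0` and `D` a product of nonzero classes, where `l` and the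
number of factors of `D` add up to `n` and there are at least `q` factors. -/
def derivativeMaps (n q : ℕ) : Set (PowerSeries ℚ → LocRing H) :=
  {F | ∃ (y : H) (l : ℕ) (D : Multiset H), y ≠ 0 ∧ D.card + l = n ∧ q ≤ D.card ∧
    (∀ h ∈ D, h ≠ 0) ∧ F = fun g => evalAt y ((PowerSeries.derivative ℚ)^[l] g) * invProd D}

theorem mul_inverse_mem_span_derivativeMaps {n : ℕ} {F : PowerSeries ℚ → LocRing H}
    (hF : F ∈ Submodule.span ℚ (derivativeMaps H n 0)) {z : H} (hz : z ≠ 0) :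
    F * (fun _ => Ring.inverse (linLoc z)) ∈ Submodule.span ℚ (derivativeMaps H (n + 1) 1) := by
  refine (Submodule.map_span_le (LinearMap.mulRight ℚ
    (fun _ : PowerSeries ℚ => Ring.inverse (linLoc z))) (derivativeMaps H n 0) _).2 ?_
    (Submodule.mem_map_of_mem hF)
  rintro _ ⟨y, l, D, hy, hn, -, hD, rfl⟩
  refine Submodule.subset_span ⟨y, l, z ::ₘ D, hy, ?_, ?_, ?_, ?_⟩
  · rw [Multiset.card_cons]; omega
  · rw [Multiset.card_cons]; omega
  · intro h hh
    rcases Multiset.mem_cons.1 hh with rfl | hh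
    exacts [hz, hD h hh]
  · funext g
    simp [invProd_cons, mul_assoc]

variable {ι : Type} [Fintype ι]

/-- The divided difference of `g` at the classes `x i`, `i ∈ s`, in the localized ring. -/
def dividedDifferenceMap (x : ι → H) (s : Finset ι) (g : PowerSeries ℚ) : LocRing H :=
  algebraMap (PSRing H) (LocRing H) (evalSeries x (dividedDifference s g))

/-- The recursion `g[s] = (g[s \ b] - g[s \ a]) / (x a - x b)` of divided differences. -/
theorem dividedDifferenceMap_eq {x : ι → H} {s : Finset ι} {a b : ι} (ha : a ∈ s) (hb : b ∈ s)
    (hab : x a ≠ x b) : dividedDifferenceMap x s =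
      (dividedDifferenceMap x (s.erase b) - dividedDifferenceMap x (s.erase a)) *
        fun _ => Ring.inverse (linLoc (x a - x b)) := by
  funext g
  have h := congrArg (fun F => algebraMap (PSRing H) (LocRing H) (evalSeries x F))
    (X_sub_X_mul_dividedDifference ha hb (fun h => hab (congrArg x h)) g)
  have hX : ∀ i, evalSeries x (MvPowerSeries.X i) = lin (x i) := fun i => by
    rw [evalSeries, MvPowerSeries.substAlgHom_X]
  simp only [map_mul, map_sub, hX] at h
  change dividedDifferenceMap x s g = (dividedDifferenceMap x (s.erase b) g -
    dividedDifferenceMap x (s.erase a) g) * _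
  have h' : linLoc (x a - x b) * dividedDifferenceMap x s g =
      dividedDifferenceMap x (s.erase b) g - dividedDifferenceMap x (s.erase a) g := by
    rw [linLoc_sub]; exact h
  rw [← h', mul_comm, ← mul_assoc,
    Ring.inverse_mul_cancel _ (isUnit_linLoc (sub_ne_zero.2 hab)), one_mul]

/-- Divided differences are combinations of fractions `g⁽ˡ⁾(y) / D`. The denominators are
nontrivial as soon as two of the classes differ, since then the recursion applies at least once.
-/
theorem dividedDifferenceMap_mem_span {x : ι → H} (hx : ∀ i, x i ≠ 0) (n : ℕ) :
    ∀ s : Finset ι, s.card = n + 1 →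
      dividedDifferenceMap x s ∈ Submodule.span ℚ (derivativeMaps H n 0) ∧
      ∀ a ∈ s, ∀ b ∈ s, x a ≠ x b →
        dividedDifferenceMap x s ∈ Submodule.span ℚ (derivativeMaps H n 1) := by
  induction n with
  | zero =>
    intro s hs
    obtain ⟨i, rfl⟩ := Finset.card_eq_one.1 hs
    constructor
    · refine Submodule.subset_span ⟨x i, 0, 0, hx i, rfl, le_rfl, by simp, ?_⟩
      funext g
      rw [dividedDifferenceMap, evalSeries_dividedDifference_of_eq (y := x i) (by simp) (by simp)]
      simp [evalAt, invProd_zero]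
    · intro a ha b hb hab
      rw [Finset.mem_singleton.1 ha, Finset.mem_singleton.1 hb] at hab
      exact absurd rfl hab
  | succ n ih =>
    intro s hs
    have h2 : ∀ a ∈ s, ∀ b ∈ s, x a ≠ x b →
        dividedDifferenceMap x s ∈ Submodule.span ℚ (derivativeMaps H (n + 1) 1) := by
      intro a ha b hb hab
      rw [dividedDifferenceMap_eq ha hb hab]
      refine mul_inverse_mem_span_derivativeMaps (Submodule.sub_mem _ ?_ ?_) (sub_ne_zero.2 hab)
      · exact (ih _ (by rw [Finset.card_erase_of_mem hb, hs]; rfl)).1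
      · exact (ih _ (by rw [Finset.card_erase_of_mem ha, hs]; rfl)).1
    refine ⟨?_, h2⟩
    by_cases h : ∃ a ∈ s, ∃ b ∈ s, x a ≠ x b
    · obtain ⟨a, ha, b, hb, hab⟩ := h
      refine Submodule.span_mono ?_ (h2 a ha b hb hab)
      rintro _ ⟨y, l, D, hy, hn, -, h⟩
      exact ⟨y, l, D, hy, hn, Nat.zero_le _, h⟩
    · push Not at h
      have hne : s.Nonempty := Finset.card_pos.1 (by omega)
      obtain ⟨a, ha⟩ := hne
      have : dividedDifferenceMap x s = (((s.card - 1).factorial : ℚ)⁻¹) • fun g =>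
          evalAt (x a) ((PowerSeries.derivative ℚ)^[n + 1] g) * invProd (0 : Multiset H) := by
        funext g
        rw [dividedDifferenceMap,
          evalSeries_dividedDifference_of_eq ⟨a, ha⟩ (fun i hi => h i hi a ha), Pi.smul_apply,
          invProd_zero, mul_one, ← evalAt_smul, evalAt, hs, Nat.add_sub_cancel,
          PowerSeries.subst_smul (hasSubst_lin_powerSeries _)]
      rw [this]
      exact Submodule.smul_mem _ _ (Submodule.subset_span
        ⟨x a, n + 1, 0, hx a, by simp, le_rfl, by simp, rfl⟩)

variable (H) in
/-- The maps sending `f` to a factor `E f k p y / D`, where `y`, `p`, `D` are as in `Term.Valid`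
for a vertex of valency `k`, and `q ≤ p`. -/
def vertexMaps (E : PowerSeries ℚ → ℕ → ℕ → H → LocRing H) (k q : ℕ) :
    Set (PowerSeries ℚ → LocRing H) :=
  {F | ∃ (y : H) (p : ℕ) (D : Multiset H), (y ≠ 0 ∧ (p = 0 ∨ p < k) ∧ D.card = p ∧ ∀ h ∈ D, h ≠ 0) ∧
    q ≤ p ∧ F = fun f => E f k p y * invProd D}

theorem comp_derivative_mem_span_vertexMaps {n q : ℕ} {F : PowerSeries ℚ → LocRing H}
    (hF : F ∈ Submodule.span ℚ (derivativeMaps H n q)) :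
    (fun f => F (PowerSeries.derivative ℚ f)) ∈
      Submodule.span ℚ (vertexMaps H derivTerm (n + 1) q) := by
  refine (Submodule.map_span_le (LinearMap.funLeft ℚ (LocRing H) (PowerSeries.derivative ℚ))
    (derivativeMaps H n q) _).2 ?_ (Submodule.mem_map_of_mem hF)
  rintro _ ⟨y, l, D, hy, hn, hq, hD, rfl⟩
  refine Submodule.subset_span ⟨y, D.card, D, ⟨hy, Or.inr (by omega), rfl, hD⟩, hq, ?_⟩
  funext f
  have : n + 1 - D.card = l + 1 := by omega
  rw [derivTerm, this]
  rfl

/-- The leading term of `yᵖ (f'(y) / yᵖ)⁽ˡ⁾` is `f⁽ˡ⁺¹⁾(y)`, and the other terms have lower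
derivatives and more factors `y` in the denominator. -/
theorem exists_laurentTerm_eq {y : H} (hy : y ≠ 0) (p l : ℕ) : ∃ c : ℕ → ℚ, ∀ f : PowerSeries ℚ,
    laurentTerm f (p + l + 1) p y = derivTerm f (p + l + 1) p y +
      ∑ i ∈ Finset.range l, c i • (derivTerm f (p + l + 1) (p + (l - i)) y *
        Ring.inverse (linLoc y) ^ (l - i)) := by
  obtain ⟨c, hc, h⟩ := exists_laurentNumerator_eq p l
  refine ⟨c, fun f => ?_⟩
  have hu : ∀ k, linLoc y ^ k * Ring.inverse (linLoc y) ^ k = 1 := fun k => by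
    rw [← mul_pow, Ring.mul_inverse_cancel _ (isUnit_linLoc hy), one_pow]
  have hsum : ∀ (s : Finset ℕ) (F : ℕ → PowerSeries ℚ), evalAt y (∑ i ∈ s, F i) =
      ∑ i ∈ s, evalAt y (F i) := fun s F => by
    induction s using Finset.induction_on with
    | empty => simpa using evalAt_smul y 0 0
    | insert a s ha ih => rw [Finset.sum_insert ha, Finset.sum_insert ha, evalAt_add, ih]
  have h1 : p + l + 1 - p - 1 = l := by omega
  rw [laurentTerm, if_neg (Nat.succ_ne_zero _), h1, iterate_derivative_mul_single,
    evalLaurentAt_mul_single hy, pow_add, mul_left_comm, ← mul_assoc (linLoc y ^ p), hu, one_mul,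
    h, hsum, Finset.sum_mul, Finset.sum_range_succ, add_comm]
  have h2 : p + l + 1 - p = l + 1 := by omega
  congr 1
  · rw [hc, one_smul, evalAt_mul, evalAt_X_pow, mul_right_comm, hu, one_mul, derivTerm, h2]
    rfl
  · refine Finset.sum_congr rfl fun i hi => ?_
    have hi := Finset.mem_range.1 hi
    have h3 : p + l + 1 - (p + (l - i)) = i + 1 := by omega
    have h4 : Ring.inverse (linLoc y) ^ l =
        Ring.inverse (linLoc y) ^ i * Ring.inverse (linLoc y) ^ (l - i) := by
      rw [← pow_add, Nat.add_sub_cancel' hi.le]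
    rw [evalAt_smul, evalAt_mul, evalAt_X_pow, smul_mul_assoc, h4, derivTerm, h3,
      Function.iterate_succ_apply]
    congr 1
    rw [← mul_assoc, mul_right_comm (linLoc y ^ i), hu, one_mul]

/-- Induction on the order `l` of the derivative: the correction terms have lower order. -/
theorem derivTerm_mem_span_laurentTerm {y : H} (hy : y ≠ 0) (q l : ℕ) :
    ∀ D : Multiset H, (∀ h ∈ D, h ≠ 0) → q ≤ D.card →
      (fun f => derivTerm f (D.card + l + 1) D.card y * invProd D) ∈
        Submodule.span ℚ (vertexMaps H laurentTerm (D.card + l + 1) q) := by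
  induction l using Nat.strong_induction_on with
  | _ l ih =>
    intro D hD hq
    obtain ⟨c, hc⟩ := exists_laurentTerm_eq hy D.card l
    -- Each lower derivative `f⁽ⁱ⁺¹⁾` takes `l - i` new factors `y` into its denominator, which
    -- keeps the number of derivatives plus the number of factors constant.
    have : (fun f => derivTerm f (D.card + l + 1) D.card y * invProd D) =
        (fun f => laurentTerm f (D.card + l + 1) D.card y * invProd D) -
        ∑ i ∈ Finset.range l, c i • fun f =>
          derivTerm f (D.card + l + 1) (D.card + (l - i)) y *
            invProd (D + Multiset.replicate (l - i) y) := by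
      funext f
      rw [Pi.sub_apply, Finset.sum_apply, hc, add_mul, Finset.sum_mul, eq_sub_iff_add_eq]
      congr 1
      refine Finset.sum_congr rfl fun i _ => ?_
      rw [Pi.smul_apply, invProd_add, invProd_replicate, smul_mul_assoc, mul_assoc,
        mul_comm (invProd D)]
    rw [this]
    refine Submodule.sub_mem _ ?_ (Submodule.sum_mem _ fun i hi => Submodule.smul_mem _ _ ?_)
    · exact Submodule.subset_span ⟨y, D.card, D, ⟨hy, Or.inr (by omega), rfl, hD⟩, hq, rfl⟩
    · have hi := Finset.mem_range.1 hi
      have hcard : (D + Multiset.replicate (l - i) y).card = D.card + (l - i) := by simp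
      have := ih i hi (D + Multiset.replicate (l - i) y) (fun h hh => by
        rcases Multiset.mem_add.1 hh with hh | hh
        · exact hD h hh
        · rw [Multiset.eq_of_mem_replicate hh]; exact hy) (by omega)
      rw [hcard] at this
      have h3 : D.card + (l - i) + i + 1 = D.card + l + 1 := by omega
      rwa [h3] at this

theorem span_vertexMaps_derivTerm_le (k q : ℕ) :
    Submodule.span ℚ (vertexMaps H derivTerm k q) ≤
      Submodule.span ℚ (vertexMaps H laurentTerm k q) := by
  rw [Submodule.span_le]
  rintro _ ⟨y, p, D, ⟨hy, hp, rfl, hD⟩, hq, rfl⟩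
  rcases Nat.eq_zero_or_pos k with rfl | hk
  · refine Submodule.subset_span ⟨y, D.card, D, ⟨hy, hp, rfl, hD⟩, hq, ?_⟩
    funext f
    rw [laurentTerm, if_pos rfl, derivTerm, Nat.zero_sub]
    rfl
  · obtain ⟨l, rfl⟩ : ∃ l, k = D.card + l + 1 := ⟨k - D.card - 1, by omega⟩
    exact derivTerm_mem_span_laurentTerm hy q l D hD hq

end VertexTerms

/-! ### Functions and gluings on a cycle -/

section CyclicPermutations

variable {β : Type} [Fintype β] {τ : Equiv.Perm β}

theorem isCycleOn_univ_of_sameCycle (hτ : ∀ b b', τ.SameCycle b b') :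
    τ.IsCycleOn ((Finset.univ : Finset β) : Set β) := by
  rw [Finset.coe_univ]
  exact ⟨Set.bijOn_univ.2 τ.bijective, fun b _ b' _ => hτ b b'⟩

theorem sum_range_pow_apply {M : Type} [AddCommMonoid M] (hτ : ∀ b b', τ.SameCycle b b') (b₀ : β)
    (F : β → M) : ∑ i ∈ Finset.range (Fintype.card β), F ((τ ^ i) b₀) = ∑ b, F b := by
  have h := isCycleOn_univ_of_sameCycle hτ
  refine Finset.sum_nbij (fun i => (τ ^ i) b₀) (by simp) ?_ ?_ (by simp)
  · intro i hi j hj hij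
    have := (h.pow_apply_eq_pow_apply (Finset.mem_univ b₀)).1 hij
    rw [Finset.card_univ] at this
    exact Nat.ModEq.eq_of_lt_of_lt this (Finset.mem_range.1 hi) (Finset.mem_range.1 hj)
  · intro b _
    obtain ⟨n, hn, hb⟩ := h.exists_pow_eq (Finset.mem_univ b₀) (Finset.mem_univ b)
    exact ⟨n, by simpa using hn, hb⟩

/-- The elements of a cycle are numbered from a base point. -/
theorem exists_cycle_index (hτ : ∀ b b', τ.SameCycle b b') (b₀ : β) : ∃ idx : β → ℕ,
    idx b₀ = 0 ∧ (∀ b, idx b < Fintype.card β) ∧ (∀ b, (τ ^ idx b) b₀ = b) ∧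
    ∀ b, idx (τ b) = idx b + 1 ∨ (idx b + 1 = Fintype.card β ∧ idx (τ b) = 0) := by
  have h := isCycleOn_univ_of_sameCycle hτ
  have hex : ∀ b, ∃ n < Fintype.card β, (τ ^ n) b₀ = b := fun b =>
    h.exists_pow_eq (Finset.mem_univ b₀) (Finset.mem_univ b)
  choose idx hlt hidx using hex
  have huniq : ∀ b n, n < Fintype.card β → (τ ^ n) b₀ = b → idx b = n := by
    intro b n hn hb
    have := (h.pow_apply_eq_pow_apply (Finset.mem_univ b₀)).1 ((hidx b).trans hb.symm)
    rw [Finset.card_univ] at this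
    exact Nat.ModEq.eq_of_lt_of_lt this (hlt b) hn
  refine ⟨idx, huniq _ _ (Fintype.card_pos_iff.2 ⟨b₀⟩) rfl, hlt, hidx, fun b => ?_⟩
  have hs : (τ ^ (idx b + 1)) b₀ = τ b := by rw [pow_succ', Equiv.Perm.mul_apply, hidx]
  rcases (show idx b + 1 ≤ Fintype.card β from hlt b).lt_or_eq with hb | hb
  · exact Or.inl (huniq _ _ hb hs)
  · refine Or.inr ⟨hb, huniq _ _ (Fintype.card_pos_iff.2 ⟨b₀⟩) ?_⟩
    rw [← hs, hb, ← Finset.card_univ, h.pow_card_apply (Finset.mem_univ b₀)]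
    rfl

/-- A function of sum zero along a cycle is a coboundary. -/
theorem exists_eq_add_of_sum_eq_zero (hτ : ∀ b b', τ.SameCycle b b') {c : β → ℤ}
    (hc : ∑ b, c b = 0) : ∃ h : β → ℤ, ∀ b, h (τ b) = h b + c b := by
  rcases isEmpty_or_nonempty β with hβ | ⟨⟨b₀⟩⟩
  · exact ⟨fun _ => 0, fun b => hβ.elim b⟩
  obtain ⟨idx, -, -, hidx, hstep⟩ := exists_cycle_index hτ b₀
  set P : ℕ → ℤ := fun i => ∑ l ∈ Finset.range i, c ((τ ^ l) b₀) with hP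
  have hPs : ∀ b, P (idx b + 1) = P (idx b) + c b := fun b => by
    simp only [hP]
    rw [Finset.sum_range_succ, hidx]
  refine ⟨fun b => P (idx b), fun b => ?_⟩
  change P (idx (τ b)) = P (idx b) + c b
  rcases hstep b with h | ⟨h, h'⟩
  · rw [h, hPs]
  · rw [h', ← hPs, h]
    simp only [hP]
    rw [sum_range_pow_apply hτ b₀ c, hc]
    rfl

/-- Consecutive intervals of lengths `c b` are laid out along a cycle. -/
theorem exists_cyclic_positions (hτ : ∀ b b', τ.SameCycle b b') (b₀ : β) (c : β → ℕ) :
    ∃ pos : β → ℕ, pos b₀ = 0 ∧ (∀ b, pos b + c b ≤ ∑ b, c b) ∧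
      (∀ b, pos (τ b) ≡ pos b + c b [MOD ∑ b, c b]) ∧
      ∀ b b', b ≠ b' → pos b + c b ≤ pos b' ∨ pos b' + c b' ≤ pos b := by
  obtain ⟨idx, h0, hlt, hidx, hstep⟩ := exists_cycle_index hτ b₀
  set P : ℕ → ℕ := fun i => ∑ l ∈ Finset.range i, c ((τ ^ l) b₀) with hP
  have hPs : ∀ b, P (idx b + 1) = P (idx b) + c b := fun b => by
    simp only [hP]
    rw [Finset.sum_range_succ, hidx]
  have hmono : Monotone P := fun i j hij =>
    Finset.sum_le_sum_of_subset (Finset.range_subset_range.2 hij)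
  have htot : P (Fintype.card β) = ∑ b, c b := sum_range_pow_apply hτ b₀ c
  refine ⟨fun b => P (idx b), by simp [h0, hP], fun b => ?_, fun b => ?_, fun b b' hb => ?_⟩
  · rw [← hPs, ← htot]
    exact hmono (hlt b)
  · rcases hstep b with h | ⟨h, h'⟩
    · simp only [h, hPs]
      exact Nat.ModEq.refl _
    · simp only [h', ← hPs, h, htot]
      simp [hP, Nat.ModEq]
  · have hne : idx b ≠ idx b' := fun h => hb (by rw [← hidx b, h, hidx b'])
    simp only [← hPs]
    rcases hne.lt_or_gt with h | h
    · exact Or.inl (hmono h)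
    · exact Or.inr (hmono h)

/-- The gluings of a cyclically ordered set of `β` half-edges to a wheel with prescribed gaps are
determined by the leg glued to one of them, which is arbitrary. -/
theorem card_cyclic_gluings [Nonempty β] (hτ : ∀ b b', τ.SameCycle b b') (m : β → ℕ) {n : ℕ}
    (hn : n = Fintype.card β + ∑ b, m b) :
    Nat.card {g : β ↪ Fin n // ∀ b b', (τ b = b' → ((g b : ℕ) + m b + 1) % n = g b') ∧
      ∀ j < m b, ((g b : ℕ) + j + 1) % n ≠ g b'} = n := by
  obtain ⟨b₀⟩ := ‹Nonempty β›
  have hn' : ∑ b, (m b + 1) = n := by rw [Finset.sum_add_distrib, hn]; simp [add_comm]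
  obtain ⟨pos, h0, hle, hstep, hsep⟩ := exists_cyclic_positions hτ b₀ (fun b => m b + 1)
  rw [hn'] at hle hstep
  have hpos : ∀ b, pos b < n := fun b => by have := hle b; omega
  have hnpos : 0 < n := (Nat.zero_le _).trans_lt (hpos b₀)
  conv_rhs => rw [← Nat.card_fin n]
  refine Nat.card_congr (Equiv.ofBijective (fun g => g.1 b₀) ⟨?_, ?_⟩)
  · rintro ⟨g, hg⟩ ⟨g', hg'⟩ (h : g b₀ = g' b₀)
    have hall : ∀ i : ℕ, g ((τ ^ i) b₀) = g' ((τ ^ i) b₀) := by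
      intro i
      induction i with
      | zero => exact h
      | succ i ih =>
        rw [pow_succ', Equiv.Perm.mul_apply]
        apply Fin.ext
        rw [← (hg _ _).1 rfl, ← (hg' _ _).1 rfl, ih]
    refine Subtype.ext (DFunLike.ext _ _ fun b => ?_)
    obtain ⟨i, -, rfl⟩ := (isCycleOn_univ_of_sameCycle hτ).exists_pow_eq (Finset.mem_univ b₀)
      (Finset.mem_univ b)
    exact hall i
  · intro s
    have hinj : Function.Injective fun b => (⟨(s + pos b) % n, Nat.mod_lt _ hnpos⟩ : Fin n) := by
      intro b b' h
      by_contra hb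
      have h1 : s + pos b ≡ s + pos b' [MOD n] := congrArg Fin.val h
      have h2 := Nat.ModEq.eq_of_lt_of_lt (Nat.ModEq.add_left_cancel' _ h1) (hpos b) (hpos b')
      rcases hsep b b' hb with h | h <;> omega
    obtain ⟨g, hg⟩ : ∃ g : β ↪ Fin n, ∀ b, (g b : ℕ) = (s + pos b) % n := ⟨⟨_, hinj⟩, fun _ => rfl⟩
    have hmod : ∀ b j, ((g b : ℕ) + j + 1) % n = (s + (pos b + j + 1)) % n := fun b j => by
      rw [hg, add_assoc, Nat.mod_add_mod]
      congr 1
      ring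
    refine ⟨⟨g, fun b b' => ⟨?_, ?_⟩⟩, ?_⟩
    · rintro rfl
      rw [hmod, hg]
      exact (hstep b).symm.add_left s
    · intro j hj h
      rw [hmod, hg] at h
      have h1 : s + (pos b + j + 1) ≡ s + pos b' [MOD n] := h
      have h2 := hle b
      have h3 := Nat.ModEq.eq_of_lt_of_lt (Nat.ModEq.add_left_cancel' _ h1) (by omega) (hpos b')
      by_cases hb : b = b'
      · subst hb; omega
      · rcases hsep b b' hb with h | h <;> omega
    · apply Fin.ext
      rw [hg, h0, add_zero]
      exact Nat.mod_eq_of_lt s.2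

end CyclicPermutations

/-! ### The series of the gluings -/

namespace GluingGraph

variable {V B : Type} [Fintype V] [Fintype B] (X : GluingGraph V B)

omit [Fintype V] [Fintype B] in
theorem base_apply (σ : X.CyclicOrdering) (b : B) : X.base (σ.1 b) = X.base b :=
  (σ.2 _ _).1 (Equiv.Perm.sameCycle_apply_left.2 (Equiv.Perm.SameCycle.refl _ _))

/-- The restriction of a cyclic ordering to the half-edges attached to `v`. -/
def rotationAt (σ : X.CyclicOrdering) (v : V) : Equiv.Perm {b : B // X.base b = v} :=
  σ.1.subtypePerm (p := fun b => X.base b = v) fun b => by rw [X.base_apply σ b]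

omit [Fintype V] [Fintype B] in
theorem coe_rotationAt (σ : X.CyclicOrdering) (v : V) (b : {b : B // X.base b = v}) :
    (X.rotationAt σ v b : B) = σ.1 b := rfl

omit [Fintype V] [Fintype B] in
theorem sameCycle_rotationAt (σ : X.CyclicOrdering) (v : V) (b b' : {b : B // X.base b = v}) :
    (X.rotationAt σ v).SameCycle b b' := by
  rw [rotationAt, Equiv.Perm.sameCycle_subtypePerm, σ.2, b.2, b'.2]

/-- The arcs of the circle inserted at `v`. -/
def arcsAt (v : V) : Finset X.Arc := Finset.univ.filter fun a => X.arcBase a = v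

theorem mem_arcsAt {v : V} {a : X.Arc} : a ∈ X.arcsAt v ↔ X.arcBase a = v := by simp [arcsAt]

theorem sum_arcsAt {M : Type} [AddCommMonoid M] {v : V} (hv : X.valency v ≠ 0) (F : X.Arc → M) :
    ∑ a ∈ X.arcsAt v, F a = ∑ b : {b : B // X.base b = v}, F (.inl b) := by
  have hne : Nonempty {b : B // X.base b = v} := by
    by_contra h
    rw [not_nonempty_iff] at h
    exact hv Nat.card_of_isEmpty
  obtain ⟨⟨b₀, hb₀⟩⟩ := hne
  rw [arcsAt, Finset.sum_filter, Fintype.sum_sum_type]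
  have h2 : ∑ w : X.Isolated, (if X.arcBase (.inr w) = v then F (.inr w) else 0) = 0 :=
    Finset.sum_eq_zero fun w _ => if_neg fun h => w.2 b₀ (hb₀.trans h.symm)
  rw [h2, add_zero, ← Finset.sum_filter]
  exact Finset.sum_subtype _
    (fun b => Finset.mem_filter.trans (and_iff_right (Finset.mem_univ _))) _

theorem card_arcsAt (v : V) : (X.arcsAt v).card = if X.valency v = 0 then 1 else X.valency v := by
  split_ifs with hv
  · have hiso : ∀ b, X.base b ≠ v := fun b hb =>
      (Nat.card_pos_iff.2 ⟨⟨(⟨b, hb⟩ : {b : B // X.base b = v})⟩, inferInstance⟩).ne' hv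
    rw [Finset.card_eq_one]
    refine ⟨.inr ⟨v, hiso⟩, Finset.ext fun a => ?_⟩
    rw [mem_arcsAt, Finset.mem_singleton]
    constructor
    · rcases a with b | w
      · exact fun h => absurd h (hiso b)
      · rintro rfl; rfl
    · rintro rfl; rfl
  · rw [Finset.card_eq_sum_ones, X.sum_arcsAt hv]
    simp [valency, Nat.card_eq_fintype_card]

theorem wheelOrder_eq (m : X.Arc →₀ ℕ) (v : V) :
    X.wheelOrder m v = X.valency v + ∑ a ∈ X.arcsAt v, m a := by
  rw [wheelOrder, arcsAt, Finset.sum_filter]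

theorem card_gluings_at (σ : X.CyclicOrdering) (m : X.Arc →₀ ℕ) (v : V) :
    Nat.card {g : {b : B // X.base b = v} ↪ Fin (X.wheelOrder m v) //
      ∀ b b' : {b : B // X.base b = v},
        (σ.1 b = b' → ((g b : ℕ) + m (.inl b) + 1) % X.wheelOrder m v = g b') ∧
        ∀ j < m (.inl b), ((g b : ℕ) + j + 1) % X.wheelOrder m v ≠ g b'} =
      if X.valency v = 0 then 1 else X.wheelOrder m v := by
  split_ifs with hv
  · have : IsEmpty {b : B // X.base b = v} := (Finite.card_eq_zero_iff).1 hv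
    rw [Nat.card_eq_one_iff_unique]
    exact ⟨⟨fun g g' => Subtype.ext (DFunLike.ext _ _ fun b => isEmptyElim b)⟩,
      ⟨⟨Function.Embedding.ofIsEmpty, fun b => isEmptyElim b⟩⟩⟩
  · have hne : Nonempty {b : B // X.base b = v} := by
      by_contra h
      rw [not_nonempty_iff] at h
      exact hv Nat.card_of_isEmpty
    have hn : X.wheelOrder m v = Fintype.card {b : B // X.base b = v} +
        ∑ b : {b : B // X.base b = v}, m (.inl b) := by
      rw [wheelOrder_eq, X.sum_arcsAt hv, valency, Nat.card_eq_fintype_card]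
    have h := card_cyclic_gluings (X.sameCycle_rotationAt σ v) (fun b => m (.inl b)) hn
    simpa only [Subtype.ext_iff, coe_rotationAt] using h

/-- The series whose divided difference is the contribution of the wheels at `v`. For positive
valency it is the derivative of `f v`: a wheel with `n` legs can be rotated in `n` ways. -/
def wheelSeries (f : V → PowerSeries ℚ) (v : V) : PowerSeries ℚ :=
  if X.valency v = 0 then f v else PowerSeries.derivative ℚ (f v)

theorem coeff_wheelSeries (f : V → PowerSeries ℚ) (m : X.Arc →₀ ℕ) (v : V) :
    PowerSeries.coeff (∑ a ∈ X.arcsAt v, m a + ((X.arcsAt v).card - 1)) (X.wheelSeries f v) =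
      ((if X.valency v = 0 then 1 else X.wheelOrder m v : ℕ) : ℚ) *
        PowerSeries.coeff (X.wheelOrder m v) (f v) := by
  rw [wheelSeries, wheelOrder_eq, card_arcsAt]
  split_ifs with hv
  · simp [hv]
  · rw [PowerSeries.coeff_derivative, mul_comm]
    have h : ∑ a ∈ X.arcsAt v, m a + (X.valency v - 1) + 1 =
      X.valency v + ∑ a ∈ X.arcsAt v, m a := by omega
    rw [h]
    congr 1
    exact_mod_cast h

theorem gluingSeries_apply (σ : X.CyclicOrdering) (f : V → PowerSeries ℚ) (m : X.Arc →₀ ℕ) :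
    X.gluingSeries σ f m = ∏ v, PowerSeries.coeff
      (∑ a ∈ X.arcsAt v, m a + ((X.arcsAt v).card - 1)) (X.wheelSeries f v) := by
  simp only [coeff_wheelSeries, Finset.prod_mul_distrib]
  rw [gluingSeries, ← Finset.sum_filter, Finset.sum_const, nsmul_eq_mul]
  congr 1
  rw [← Nat.cast_prod]
  congr 1
  rw [← Fintype.card_subtype, ← Nat.card_eq_fintype_card]
  simp only [← X.card_gluings_at σ m]
  rw [← Nat.card_pi]
  exact Nat.card_congr (Equiv.subtypePiEquivPi (p := fun v
    (g : {b : B // X.base b = v} ↪ Fin (X.wheelOrder m v)) =>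
      ∀ b b' : {b : B // X.base b = v},
        (σ.1 b = b' → ((g b : ℕ) + m (.inl b) + 1) % X.wheelOrder m v = g b') ∧
        ∀ j < m (.inl b), ((g b : ℕ) + j + 1) % X.wheelOrder m v ≠ g b'))

/-- A monomial in the arcs splits uniquely into monomials in the arcs at the single vertices, so the
series of all gluings is a product over the vertices. -/
theorem gluingSeries_eq (σ : X.CyclicOrdering) (f : V → PowerSeries ℚ) :
    X.gluingSeries σ f = ∏ v, dividedDifference (X.arcsAt v) (X.wheelSeries f v) := by
  ext m
  change X.gluingSeries σ f m = _
  rw [gluingSeries_apply, MvPowerSeries.coeff_prod]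
  -- The only splitting of `m` that contributes has at `v` the exponents of the arcs at `v`.
  set l₀ : V →₀ (X.Arc →₀ ℕ) :=
    Finsupp.equivFunOnFinite.symm fun v => m.filter fun a => X.arcBase a = v with hl₀
  have hl₀v : ∀ v a, l₀ v a = if X.arcBase a = v then m a else 0 := fun v a => by
    simp [hl₀, Finsupp.filter_apply]
  have hsupp : ∀ v, (l₀ v).support ⊆ X.arcsAt v := fun v a ha => by
    rw [mem_arcsAt]
    by_contra h
    exact Finsupp.mem_support_iff.1 ha (by rw [hl₀v, if_neg h])
  rw [Finset.sum_eq_single l₀]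
  · refine Finset.prod_congr rfl fun v _ => ?_
    rw [coeff_dividedDifference, if_pos (hsupp v), Finsupp.degree_eq_sum]
    congr 3
    rw [arcsAt, Finset.sum_filter]
    exact Finset.sum_congr rfl fun a _ => (hl₀v v a).symm
  · intro l hl hne
    by_contra hprod
    have hs : ∀ v, (l v).support ⊆ X.arcsAt v := fun v => by
      by_contra h
      exact hprod (Finset.prod_eq_zero (Finset.mem_univ v)
        (by rw [coeff_dividedDifference, if_neg h]))
    have hsv : ∀ v a, X.arcBase a ≠ v → l v a = 0 := fun v a h =>
      Finsupp.notMem_support_iff.1 fun ha => h (X.mem_arcsAt.1 (hs v ha))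
    refine hne (Finsupp.ext fun v => Finsupp.ext fun a => ?_)
    rw [hl₀v]
    split_ifs with h
    · rw [← (Finset.mem_finsuppAntidiag.1 hl).1, Finsupp.finsetSum_apply,
        Finset.sum_eq_single v]
      · exact fun w _ hw => hsv w a fun h' => hw (h'.symm.trans h)
      · exact fun h => absurd (Finset.mem_univ v) h
    · exact hsv v a h
  · intro h
    refine absurd (Finset.mem_finsuppAntidiag.2 ⟨Finsupp.ext fun a => ?_, Finset.subset_univ _⟩) h
    change (∑ v, l₀ v) a = m a
    rw [Finsupp.finsetSum_apply]
    simp [hl₀v]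

end GluingGraph

/-! ### Cohomology classes of arcs, and trees -/

namespace GluingGraph

variable {V B : Type} [Fintype V] [Fintype B] (X : GluingGraph V B)

omit [Fintype V] [Fintype B] in
/-- The circle on which an arc lies is a cycle that runs through the arc once. -/
theorem arcClass_ne_zero (σ : X.CyclicOrdering) (a : X.Arc) : X.arcClass σ a ≠ 0 := by
  set z : X.CircleDart → ℤ := fun d => match d with
    | .edge _ => 0
    | .fwd b => if X.base b = X.arcBase a then 1 else 0
    | .bwd b => if X.base b = X.arcBase a then -1 else 0
    | .ring w o => if w.1 = X.arcBase a then (if o then 1 else -1) else 0 with hz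
  have hmem : z ∈ (X.circleGraph σ).cycles := by
    constructor
    · rintro (b | b | b | ⟨w, o⟩)
      · simp [circleGraph, hz]
      · simp only [circleGraph, hz, X.base_apply σ]
        split_ifs <;> rfl
      · have : X.base (σ.1.symm b) = X.base b := by
          conv_rhs => rw [← σ.1.apply_symm_apply b, X.base_apply σ]
        simp only [circleGraph, hz, this]
        split_ifs <;> rfl
      · simp only [circleGraph, hz]
        cases o <;> split_ifs <;> simp_all
    · rintro (b | b | b | ⟨w, o⟩) h
      · simp only [circleGraph, hz]
        split_ifs <;> rfl
      · simp only [circleGraph, hz]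
        split_ifs <;> rfl
      · simp only [circleGraph, hz]
        split_ifs <;> rfl
      · exact absurd rfl h
  intro h
  have h1 : X.arcClass σ a ⟨z, hmem⟩ = 0 := by rw [h]; rfl
  rcases a with b | w
  · change z (.fwd b) = 0 at h1
    simp [hz, arcBase] at h1
  · change z (.ring w true) = 0 at h1
    simp [hz, arcBase] at h1

/-- The divergence of a function on half-edges at a vertex. -/
def divergence (w : B → ℤ) (v : V) : ℤ := ∑ b, if X.base b = v then w b else 0

omit [Fintype V] in
theorem divergence_add (w w' : B → ℤ) (v : V) :
    X.divergence (w + w') v = X.divergence w v + X.divergence w' v := by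
  rw [divergence, divergence, divergence, ← Finset.sum_add_distrib]
  refine Finset.sum_congr rfl fun b _ => ?_
  split_ifs <;> simp

omit [Fintype V] in
/-- A cycle of a gluing graph extends over the inserted circles. -/
theorem exists_cycle_edge_eq (σ : X.CyclicOrdering) {w : B → ℤ} (hw : ∀ b, w (X.opp b) = -w b)
    (hdiv : ∀ v, X.divergence w v = 0) :
    ∃ z : (X.circleGraph σ).cycles, ∀ b, z.1 (.edge b) = w b := by
  have hex : ∀ v, ∃ h : {b : B // X.base b = v} → ℤ, ∀ b, h (X.rotationAt σ v b) =
      h b + -w (X.rotationAt σ v b) := fun v => by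
    refine exists_eq_add_of_sum_eq_zero (X.sameCycle_rotationAt σ v)
      (c := fun b => -w (X.rotationAt σ v b)) ?_
    rw [Finset.sum_neg_distrib, Equiv.sum_comp (X.rotationAt σ v) (fun b => w b), neg_eq_zero,
      ← hdiv v, divergence, ← Finset.sum_filter]
    exact (Finset.sum_subtype _
      (fun b => Finset.mem_filter.trans (and_iff_right (Finset.mem_univ _))) _).symm
  choose h hh using hex
  have hσ : ∀ b, h (X.base (σ.1 b)) ⟨σ.1 b, rfl⟩ = h (X.base b) ⟨b, rfl⟩ - w (σ.1 b) := by
    have aux : ∀ (b : B) (v : V) (hb : X.base b = v) (hb' : X.base (σ.1 b) = v),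
        h v ⟨σ.1 b, hb'⟩ = h v ⟨b, hb⟩ - w (σ.1 b) := fun b v hb hb' => hh v ⟨b, hb⟩
    intro b
    have aux2 : ∀ (v : V) (hb' : X.base (σ.1 b) = v),
        h (X.base (σ.1 b)) ⟨σ.1 b, rfl⟩ = h v ⟨σ.1 b, hb'⟩ := by rintro v rfl; rfl
    rw [aux2 _ (X.base_apply σ b), aux b _ rfl]
  set k : B → ℤ := fun b => h (X.base b) ⟨b, rfl⟩ with hk
  -- Kirchhoff's law at the end of `b` on the circle.
  have hk' : ∀ b, k b = k (σ.1.symm b) - w b := fun b => by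
    have h1 : k (σ.1 (σ.1.symm b)) = k (σ.1.symm b) - w (σ.1 (σ.1.symm b)) := hσ (σ.1.symm b)
    rwa [σ.1.apply_symm_apply] at h1
  refine ⟨⟨fun d => match d with
    | .edge b => w b
    | .fwd b => k b
    | .bwd b => -k (σ.1.symm b)
    | .ring _ _ => 0, ?_, ?_⟩, fun b => rfl⟩
  · rintro (b | b | b | ⟨w, o⟩) <;> simp [circleGraph, hw]
  · rintro (b | b | b | ⟨w, o⟩) hd <;> simp only [circleGraph]
    · linarith [hk' b]
    · linarith [hk' b]
    · linarith [hk' b]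
    · simp

/-- If the arcs of each circle have the same class, then the edges have class zero, hence there is
no nonzero flow on the gluing graph. -/
theorem flow_eq_zero {σ : X.CyclicOrdering}
    (hσ : ∀ v, ∀ a ∈ X.arcsAt v, ∀ a' ∈ X.arcsAt v, X.arcClass σ a = X.arcClass σ a')
    {w : B → ℤ} (hw : ∀ b, w (X.opp b) = -w b) (hdiv : ∀ v, X.divergence w v = 0) (b : B) :
    w b = 0 := by
  obtain ⟨z, hz⟩ := X.exists_cycle_edge_eq σ hw hdiv
  have hbase : X.base (σ.1.symm b) = X.base b := by
    conv_rhs => rw [← σ.1.apply_symm_apply b, X.base_apply σ]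
  have h1 : z.1 (.fwd b) = z.1 (.fwd (σ.1.symm b)) :=
    LinearMap.congr_fun (hσ (X.base b) (.inl b) (X.mem_arcsAt.2 rfl) (.inl (σ.1.symm b))
      (X.mem_arcsAt.2 hbase)) z
  have h2 : z.1 (.bwd b) = -z.1 (.fwd (σ.1.symm b)) := by
    have := z.2.1 (.bwd b)
    change z.1 (.fwd (σ.1.symm b)) = -z.1 (.bwd b) at this
    rw [this, neg_neg]
  have h3 : z.1 (.edge b) + z.1 (.fwd b) + z.1 (.bwd b) = 0 :=
    z.2.2 (.edge b) (by simp [circleGraph])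
  rw [← hz b]
  linarith

/-- The unit flow along one edge. -/
def edgeFlow (b : B) : B → ℤ := fun b' =>
  (if b' = b then 1 else 0) - if b' = X.opp b then 1 else 0

omit [Fintype V] [Fintype B] in
theorem edgeFlow_opp (b b' : B) : X.edgeFlow b (X.opp b') = -X.edgeFlow b b' := by
  have h1 : X.opp b' = b ↔ b' = X.opp b :=
    ⟨fun h => by rw [← h, X.opp_opp], fun h => by rw [h, X.opp_opp]⟩
  have h2 : X.opp b' = X.opp b ↔ b' = b :=
    ⟨fun h => by rw [← X.opp_opp b', h, X.opp_opp], fun h => by rw [h]⟩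
  simp only [edgeFlow, h1, h2]
  ring

omit [Fintype V] in
theorem divergence_edgeFlow (b : B) (v : V) : X.divergence (X.edgeFlow b) v =
    (if X.base b = v then 1 else 0) - if X.base (X.opp b) = v then 1 else 0 := by
  have h : ∀ b', (if X.base b' = v then X.edgeFlow b b' else 0) =
      (if b' = b then if X.base b = v then 1 else 0 else 0) -
        if b' = X.opp b then if X.base (X.opp b) = v then 1 else 0 else 0 := fun b' => by
    by_cases h1 : b' = b
    · subst h1
      have := (X.opp_ne b').symm
      simp [edgeFlow, this]
    · by_cases h2 : b' = X.opp b
      · subst h2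
        simp [edgeFlow, h1]
        split_ifs <;> rfl
      · simp [edgeFlow, h1, h2]
  rw [divergence, Finset.sum_congr rfl fun b' _ => h b', Finset.sum_sub_distrib]
  simp

/-- There is a unit flow from `u` to `v` that does not use the edge of `b₀`. -/
def HasFlowAvoiding (b₀ : B) (u v : V) : Prop :=
  ∃ w : B → ℤ, (∀ b, w (X.opp b) = -w b) ∧ w b₀ = 0 ∧
    ∀ x, X.divergence w x = (if u = x then 1 else 0) - if v = x then 1 else 0

omit [Fintype V] in
theorem HasFlowAvoiding.refl (b₀ : B) (u : V) : X.HasFlowAvoiding b₀ u u :=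
  ⟨0, by simp, rfl, fun x => by simp [divergence]⟩

omit [Fintype V] in
variable {X} in
theorem HasFlowAvoiding.cons {b₀ b : B} {v : V} (h1 : b₀ ≠ b) (h2 : b₀ ≠ X.opp b)
    (h : X.HasFlowAvoiding b₀ (X.base (X.opp b)) v) : X.HasFlowAvoiding b₀ (X.base b) v := by
  obtain ⟨w, hw, h0, hdiv⟩ := h
  refine ⟨X.edgeFlow b + w, fun b' => ?_, ?_, fun x => ?_⟩
  · simp only [Pi.add_apply, X.edgeFlow_opp, hw]; ring
  · simp [edgeFlow, h1, h2, h0]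
  · rw [divergence_add, divergence_edgeFlow, hdiv]; ring

/-- If an edge is a loop, is doubled or is not a bridge, then its ends are joined by a path that
avoids it, and the two together carry a nonzero flow, which `flow_eq_zero` excludes. -/
theorem isTree_of_arcClass_eq (hX : X.Connected) {σ : X.CyclicOrdering}
    (hσ : ∀ v, ∀ a ∈ X.arcsAt v, ∀ a' ∈ X.arcsAt v, X.arcClass σ a = X.arcClass σ a') :
    X.IsTree := by
  -- Adding the unit flow along `b` closes up the flow that avoids `b`.
  have key : ∀ b, ¬ X.HasFlowAvoiding b (X.base (X.opp b)) (X.base b) := by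
    rintro b ⟨w, hw, h0, hdiv⟩
    have := X.flow_eq_zero hσ (w := X.edgeFlow b + w)
      (fun b' => by simp only [Pi.add_apply, X.edgeFlow_opp, hw]; ring)
      (fun v => by rw [divergence_add, divergence_edgeFlow, hdiv]; ring) b
    simp [edgeFlow, h0, (X.opp_ne b).symm] at this
  have hloop : ∀ b, X.base (X.opp b) ≠ X.base b := fun b h => by
    have := key b
    rw [h] at this
    exact this (.refl X b _)
  refine ⟨hloop, fun b b' h h' => ?_, hX, ?_⟩
  · by_contra hb
    refine key b ?_
    rw [h']
    refine .cons (fun h2 => hloop b ?_) (by rwa [X.opp_opp]) ?_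
    · rw [h', ← h2]
    · rw [X.opp_opp, h]
      exact .refl X b _
  · rw [SimpleGraph.isAcyclic_iff_forall_isBridge]
    refine Sym2.ind fun u v huv => ?_
    rw [SimpleGraph.isBridge_iff]
    intro hr
    obtain ⟨-, b, rfl, rfl⟩ := (SimpleGraph.mem_edgeSet _).1 huv
    refine key b ?_
    obtain ⟨p⟩ := hr.symm
    have hwalk : ∀ (x y : V)
        (p : (X.toSimple.deleteEdges {s(X.base b, X.base (X.opp b))}).Walk x y),
        X.HasFlowAvoiding b x y := by
      intro x y p
      induction p with
      | nil => exact .refl X b _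
      | cons hadj p ih =>
        obtain ⟨⟨-, b', rfl, rfl⟩, hne⟩ := SimpleGraph.deleteEdges_adj.1 hadj
        refine .cons ?_ ?_ ih
        · rintro rfl; exact hne rfl
        · rintro rfl
          rw [X.opp_opp] at hne
          exact hne Sym2.eq_swap
    exact hwalk _ _ p

end GluingGraph

/-! ### Expansion of a substitution -/

theorem submodule_prod_mem_prod {A κ : Type} [CommRing A] [Algebra ℚ A] (s : Finset κ)
    (M : κ → Submodule ℚ A) (x : κ → A) (h : ∀ i, x i ∈ M i) : ∏ i ∈ s, x i ∈ ∏ i ∈ s, M i := by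
  induction s using Finset.induction_on with
  | empty => exact Submodule.one_le.1 le_rfl
  | insert a s ha ih =>
    rw [Finset.prod_insert ha, Finset.prod_insert ha]
    exact Submodule.mul_mem_mul (h a) ih

/-- The class in `ℬ_s` of a graph, as a linear function of its decoration. -/
def locDiag {D : Type} [Finite D] (Γ : TriGraph D) : LocRing Γ.H1 →ₗ[ℚ] SpaceBs :=
  (Submodule.mkQ _).comp (DirectSum.lof ℚ Diagram (fun Γ => locFunctor.obj Γ.coh) ⟨D, Γ⟩)

theorem localize_diag {D : Type} [Finite D] (Γ : TriGraph D) (x : PSRing Γ.H1) :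
    localize (diag psFunctor Γ x) = locDiag Γ (algebraMap (PSRing Γ.H1) (LocRing Γ.H1) x) :=
  congrArg (Submodule.Quotient.mk (p := Submodule.span ℚ {r | Rel locFunctor r}))
    (preMap_pre locTrans Γ x)

namespace GluingGraph

variable {V B : Type} [Fintype V] [Fintype B] (X : GluingGraph V B)

/-- The least number of denominator factors needed at `v`: `0` if all arcs at `v` have the same
class, and `1` otherwise. -/
def minFactors (σ : X.CyclicOrdering) (v : V) : ℕ :=
  if ∃ a ∈ X.arcsAt v, ∃ a' ∈ X.arcsAt v, X.arcClass σ a ≠ X.arcClass σ a' then 1 else 0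

/-- The contribution of the wheels at `v` to the decoration of the graph glued along `σ`. -/
def vertexFactor (σ : X.CyclicOrdering) (v : V) (f : PowerSeries ℚ) :
    LocRing (X.circleGraph σ).H1 :=
  dividedDifferenceMap (X.arcClass σ) (X.arcsAt v)
    (if X.valency v = 0 then f else PowerSeries.derivative ℚ f)

theorem vertexFactor_mem_span (σ : X.CyclicOrdering) (v : V) :
    X.vertexFactor σ v ∈ Submodule.span ℚ
      (vertexMaps (X.circleGraph σ).H1 derivTerm (X.valency v) (X.minFactors σ v)) := by
  obtain ⟨n, hn⟩ : ∃ n, (X.arcsAt v).card = n + 1 :=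
    ⟨(X.arcsAt v).card - 1, by rw [card_arcsAt]; split_ifs <;> omega⟩
  have hdd : dividedDifferenceMap (X.arcClass σ) (X.arcsAt v) ∈
      Submodule.span ℚ (derivativeMaps (X.circleGraph σ).H1 n (X.minFactors σ v)) := by
    have h := dividedDifferenceMap_mem_span (X.arcClass_ne_zero σ) n _ hn
    rw [minFactors]
    split_ifs with hne
    · obtain ⟨a, ha, a', ha', hne⟩ := hne
      exact h.2 a ha a' ha' hne
    · exact h.1
  rw [card_arcsAt] at hn
  by_cases hv : X.valency v = 0
  · have hF : X.vertexFactor σ v = dividedDifferenceMap (X.arcClass σ) (X.arcsAt v) := by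
      funext f
      rw [vertexFactor, if_pos hv]
    rw [if_pos hv] at hn
    obtain rfl : n = 0 := by omega
    rw [hF, hv]
    refine Submodule.span_mono ?_ hdd
    rintro _ ⟨y, l, D, hy, hl, hq, hD, rfl⟩
    refine ⟨y, 0, D, ⟨hy, Or.inl rfl, by omega, hD⟩, by omega, ?_⟩
    obtain rfl : l = 0 := by omega
    rfl
  · have hF : X.vertexFactor σ v = fun f =>
        dividedDifferenceMap (X.arcClass σ) (X.arcsAt v) (PowerSeries.derivative ℚ f) := by
      funext f
      rw [vertexFactor, if_neg hv]
    rw [if_neg hv] at hn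
    rw [hF, hn]
    exact comp_derivative_mem_span_vertexMaps hdd

theorem algebraMap_gluingSeries (σ : X.CyclicOrdering) :
    (fun f : V → PowerSeries ℚ => algebraMap (PSRing (X.circleGraph σ).H1) (LocRing _)
      (evalSeries (X.arcClass σ) (X.gluingSeries σ f))) =
      ∏ v, fun f => X.vertexFactor σ v (f v) := by
  funext f
  rw [gluingSeries_eq, map_prod, map_prod, Finset.prod_apply]
  rfl

/-- The diagrams of valid terms with denominators as required by the classes of the arcs. -/
def termMaps (E : ∀ {H : Type} [AddCommGroup H] [Module.Free ℤ H] [Module.Finite ℤ H],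
    PowerSeries ℚ → ℕ → ℕ → H → LocRing H) : Set ((V → PowerSeries ℚ) → SpaceBs) :=
  {G | ∃ T : Term X, (T.Valid ∧ ∀ v, X.minFactors T.σ v ≤ T.p v) ∧
    (fun f => locDiag (X.circleGraph T.σ)
      (∏ v, E (f v) (X.valency v) (T.p v) (T.y v) * invProd (T.den v) :
        LocRing (X.circleGraph T.σ).H1)) = G}

open scoped Pointwise in
theorem localize_substitution_mem_span
    (E : ∀ {H : Type} [AddCommGroup H] [Module.Free ℤ H] [Module.Finite ℤ H],
      PowerSeries ℚ → ℕ → ℕ → H → LocRing H)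
    (hE : ∀ (H : Type) [AddCommGroup H] [Module.Free ℤ H] [Module.Finite ℤ H] (k q : ℕ),
      Submodule.span ℚ (vertexMaps H derivTerm k q) ≤ Submodule.span ℚ (vertexMaps H E k q)) :
    (fun f => localize (X.substitution f)) ∈ Submodule.span ℚ (X.termMaps E) := by
  have hsum : (fun f => localize (X.substitution f)) = ∑ σ : X.CyclicOrdering,
      (locDiag (X.circleGraph σ)).compLeft (V → PowerSeries ℚ)
        (∏ v, fun f => X.vertexFactor σ v (f v) :
          (V → PowerSeries ℚ) → LocRing (X.circleGraph σ).H1) := by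
    funext f
    rw [Finset.sum_apply, substitution, map_sum]
    refine Finset.sum_congr rfl fun σ _ => ?_
    rw [localize_diag, ← algebraMap_gluingSeries]
    rfl
  rw [hsum]
  refine Submodule.sum_mem _ fun σ _ => ?_
  have hprod : (∏ v, fun f : V → PowerSeries ℚ => X.vertexFactor σ v (f v)) ∈
      Submodule.span ℚ (∏ v, (fun (F : PowerSeries ℚ → LocRing (X.circleGraph σ).H1)
        (f : V → PowerSeries ℚ) => F (f v)) ''
          vertexMaps _ E (X.valency v) (X.minFactors σ v)) := by
    rw [← Submodule.prod_span]
    refine submodule_prod_mem_prod _ _ _ fun v => ?_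
    have h := Submodule.mem_map_of_mem (f := LinearMap.funLeft ℚ (LocRing (X.circleGraph σ).H1)
      (fun f : V → PowerSeries ℚ => f v)) (hE _ _ _ (X.vertexFactor_mem_span σ v))
    rw [Submodule.map_span] at h
    exact h
  refine (Submodule.map_span_le _ _ _).2 ?_ (Submodule.mem_map_of_mem hprod)
  intro G hG
  obtain ⟨g, hg, rfl⟩ := (Set.mem_fintype_prod _ _).1 hG
  choose F hF hFg using hg
  choose y p D hvalid hq hFE using hF
  refine Submodule.subset_span ⟨⟨σ, y, p, D⟩, ⟨hvalid, hq⟩, ?_⟩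
  funext f
  refine congrArg (locDiag (X.circleGraph σ)) ?_
  rw [Finset.prod_apply]
  refine Finset.prod_congr rfl fun v _ => ?_
  rw [← hFg, hFE]

/-- Both formulas, for the factors `E = derivTerm` and `E = laurentTerm`: the passage from
`derivTerm` to `E` at one vertex is the hypothesis `hE`. -/
theorem exists_terms (hX : X.Connected)
    (E : ∀ {H : Type} [AddCommGroup H] [Module.Free ℤ H] [Module.Finite ℤ H],
      PowerSeries ℚ → ℕ → ℕ → H → LocRing H)
    (hE : ∀ (H : Type) [AddCommGroup H] [Module.Free ℤ H] [Module.Finite ℤ H] (k q : ℕ),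
      Submodule.span ℚ (vertexMaps H derivTerm k q) ≤ Submodule.span ℚ (vertexMaps H E k q)) :
    ∃ (N : ℕ) (c : Fin N → ℚ) (T : Fin N → Term X),
      (∀ j, (T j).Valid ∧ (¬ X.IsTree → 0 < ∑ v, (T j).p v)) ∧
      ∀ f : V → PowerSeries ℚ, localize (X.substitution f) =
        ∑ j, c j • locDiag (X.circleGraph (T j).σ)
          (∏ v, E (f v) (X.valency v) ((T j).p v) ((T j).y v) * invProd ((T j).den v) :
            LocRing (X.circleGraph (T j).σ).H1) := by
  obtain ⟨N, c, G, hG⟩ := Submodule.mem_span_set'.1 (X.localize_substitution_mem_span E hE)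
  choose T hT hTG using fun j => (G j).2
  refine ⟨N, c, T, fun j => ⟨(hT j).1, fun htree => ?_⟩, fun f => ?_⟩
  · by_contra hpos
    refine htree (X.isTree_of_arcClass_eq hX (σ := (T j).σ) fun v a ha a' ha' => ?_)
    by_contra hne
    have h1 : (T j).p v = 0 := by
      have := Finset.single_le_sum (f := (T j).p) (fun v _ => Nat.zero_le _) (Finset.mem_univ v)
      omega
    have h2 := (hT j).2 v
    rw [minFactors, if_pos ⟨a, ha, a', ha', hne⟩] at h2
    omega
  · rw [← congrFun hG f, Finset.sum_apply]
    refine Finset.sum_congr rfl fun j _ => ?_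
    rw [Pi.smul_apply, ← hTG j]

end GluingGraph
end GluingDiagrams
end

open GluingDiagrams
theorem mainTheorem5 {V B : Type} [Fintype V] [Fintype B] (X : GluingGraph V B)
    (hX : X.Connected) :
    (∃ (N : ℕ) (c : Fin N → ℚ) (T : Fin N → Term X),
      (∀ j, (T j).Valid ∧ (¬ X.IsTree → 0 < ∑ v, (T j).p v)) ∧
      ∀ f : V → PowerSeries ℚ,
        localize (X.substitution f) = ∑ j, c j • (T j).derivDiagram f) ∧
    (∃ (N : ℕ) (c : Fin N → ℚ) (T : Fin N → Term X),
      (∀ j, (T j).Valid ∧ (¬ X.IsTree → 0 < ∑ v, (T j).p v)) ∧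
      ∀ f : V → PowerSeries ℚ,
        localize (X.substitution f) = ∑ j, c j • (T j).laurentDiagram f) :=
  ⟨X.exists_terms hX derivTerm fun _ _ _ _ _ _ => le_rfl,
    X.exists_terms hX laurentTerm fun _ _ _ _ => span_vertexMaps_derivTerm_le⟩
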